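/- Let $N,d\ge 1$ be integers, $H\in(0,1)$, $c>0$, $0<a<b<\infty$ and $0<M<\infty$. Let $X^H=(X^H_t,\ t\in\mathbb{R}_+^N)$ be a $d$-dimensional $N$-parameter fractional Brownian sheet with Hurst parameter $H$, that is, a continuous $\mathbb{R}^d$-valued centered Gaussian process with independent coordinate processes, each with covariance $$\mathbb{E}\big[(X^H_t)^j (X^H_s)^j\big]=\prod_{i=1}^N \frac{c}{2}\big(t_i^{2H}+s_i^{2H}-|t_i-s_i|^{2H}\big),\qquad s,t\in\mathbb{R}_+^N,\ 1\le j\le d.$$ Then there exists a constant $K\in(0,\infty)$, depending only on $N,d,H,c,a,b,M$, such that for all compact sets $A\subset\{x\in\mathbb{R}^d:\|x\|<M\}$, $$K\,\mathrm{Cap}_{d-(N/H)}(A)\le \mathbb{P}\{\exists\, t\in[a,b]^N: X^H_t\in A\}.$$ Here $\|\cdot\|$ is the Euclidean norm. For $\beta\ge 0$, $$\mathrm{Cap}_\beta(A)=\Big(\inf_\mu \iint k_\beta(x-y)\,\mu(dx)\,\mu(dy)\Big)^{-1},$$ where the infimum is over all Borel probability measures $\mu$ on $\mathbb{R}^d$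 with support in $A$, with $1/\infty=0$ and $\inf\emptyset=\infty$, and where $k_\beta(x)=\|x\|^{-\beta}$ if $\beta>0$, $k_0(x)=\ln(3M/\|x\|)$, and $k_\beta(0)=\infty$. For $\beta<0$, $\mathrm{Cap}_\beta(A)=1$ if $A\ne\emptyset$ and $\mathrm{Cap}_\beta(\emptyset)=0$. -/

import Mathlib

open MeasureTheory ProbabilityTheory
open scoped NNReal ENNReal

noncomputable section

/-- The `k`-energy `∬ k (x - y) μ(dx) μ(dy)` of a measure `μ`, for a kernel with values in
`[0, ∞]`. -/
def kernelEnergy {d : ℕ} (k : EuclideanSpace ℝ (Fin d) → ℝ≥0∞)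
    (μ : Measure (EuclideanSpace ℝ (Fin d))) : ℝ≥0∞ :=
  ∫⁻ x, ∫⁻ y, k (x - y) ∂μ ∂μ

/-- The `k`-capacity of `E`: the inverse of the infimum of the `k`-energies of the probability
measures carried by `E` (for closed `E`, those with support contained in `E`). The inverse is taken
in `[0, ∞]`, so the capacity is `0` if no such measure has finite energy. -/
def kernelCapacity {d : ℕ} (k : EuclideanSpace ℝ (Fin d) → ℝ≥0∞)
    (E : Set (EuclideanSpace ℝ (Fin d))) : ℝ≥0∞ :=
  (⨅ (μ : Measure (EuclideanSpace ℝ (Fin d))) (_ : IsProbabilityMeasure μ) (_ : μ Eᶜ = 0),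
    kernelEnergy k μ)⁻¹

open Classical in
/-- The Newtonian `β`-kernel for `β ≥ 0`: `‖x‖ ^ (-β)` if `β > 0` and `log (3 M / ‖x‖)` if `β = 0`,
with value `∞` at the origin. (For `β = 0` the logarithm is positive for `‖x‖ < 3 M`, hence on all
differences of points of the ball of radius `M`.) -/
def newtonKernel {d : ℕ} (M β : ℝ) (x : EuclideanSpace ℝ (Fin d)) : ℝ≥0∞ :=
  if x = 0 then ⊤
  else if β = 0 then ENNReal.ofReal (Real.log (3 * M / ‖x‖))
  else ENNReal.ofReal (‖x‖ ^ (-β))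

open Classical in
/-- The Newtonian capacity `Cap_β`, for subsets of the ball of radius `M`: the capacity for the
Newtonian `β`-kernel if `β ≥ 0`, and identically `1` on nonempty sets if `β < 0`. The empty set has
capacity `0` for every `β`. -/
def newtonCapacity {d : ℕ} (M β : ℝ) (E : Set (EuclideanSpace ℝ (Fin d))) : ℝ≥0∞ :=
  if β < 0 then (if E.Nonempty then 1 else 0) else kernelCapacity (newtonKernel M β) E

/-- `X = (X_t, t ∈ ℝ₊^N)` is a `d`-dimensional `N`-parameter fractional Brownian sheet with Hurst
parameter `H` and scale constant `c`: an (almost surely) continuous centered Gaussian process with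
independent coordinate processes, each with covariance
`∏ i, c / 2 * (t_i ^ (2H) + s_i ^ (2H) - |t_i - s_i| ^ (2H))`. -/
structure IsFractionalBrownianSheet {N d : ℕ} {Ω : Type*} [MeasurableSpace Ω] (H c : ℝ)
    (X : (Fin N → ℝ≥0) → Ω → EuclideanSpace ℝ (Fin d)) (P : Measure Ω) : Prop where
  measurable : ∀ t, Measurable (X t)
  gaussian : IsGaussianProcess X P
  centered : ∀ t j, ∫ ω, X t ω j ∂P = 0
  indep : iIndepFun (fun (j : Fin d) (ω : Ω) (t : Fin N → ℝ≥0) => X t ω j) P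
  covariance : ∀ s t j, ∫ ω, X t ω j * X s ω j ∂P =
    ∏ i, c / 2 * ((t i : ℝ) ^ (2 * H) + (s i : ℝ) ^ (2 * H) - |(t i : ℝ) - s i| ^ (2 * H))
  continuous_paths : ∀ᵐ ω ∂P, Continuous fun t => X t ω

end

/-! The proof is a second moment argument on the `μ`-weighted time the sheet spends near points of
`A`. For a probability measure `μ` carried by `A` and `ε ≤ 1`, let `J_ε` be the `μ ⊗ Lebesgue`
measure of the pairs `(x, t)`, `t ∈ [a, b]^N`, such that every coordinate of `X_t - x` is at most
`ε` in absolute value. Cauchy-Schwarz gives `P (J_ε ≠ 0) ≥ (E J_ε)² / E J_ε²`. The first moment is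
at least a constant times `ε ^ d`, because the Gaussian densities are bounded below on a bounded set
(`exists_le_measure_one_point`). For the second, `X_t` is regressed coordinatewise on `X_s`: the
residual is independent of `X_s`, its standard deviation is comparable to `‖t - s‖ ^ H`, and the
regression coefficient is within `O(‖t - s‖ ^ H)` of `1` (`exists_sheetCov_bounds`). Hence the
probability of being near `x` at time `s` and near `y` at time `t` is `O(ε² / max (‖t - s‖ ^ H) ‖x -
y‖) ^ d` (`exists_measure_two_point_le`). Integrating this over `t` produces the Newtonian kernel of
exponent `d - N / H`, or a bounded function if that exponent is negative
(`exists_lintegral_inv_max_le`). So `E J_ε²` is at most a constant times `ε ^ (2 d)` times the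
energy of `μ`; the powers of `ε` cancel, and compactness together with continuity of paths allows `ε
→ 0` (`exists_hitting_bound`). Taking the supremum over `μ` gives the capacity. -/

/-! ### Covariance bounds for fractional Brownian motion and the sheet -/

/-- The covariance function of one-parameter fractional Brownian motion. -/
noncomputable def fbmCov (H c s t : ℝ) : ℝ :=
  c / 2 * (t ^ (2 * H) + s ^ (2 * H) - |t - s| ^ (2 * H))

/-- For `u = s / t ∈ [a / b, 1]` one has `1 - u ^ H ≤ 1 - u = (1 - u) ^ (1 - H) * (1 - u) ^ H`. What
matters is that the constant is less than `1` when `a < b`: this keeps the conditional variance from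
degenerating. -/
lemma abs_rpow_sub_rpow_le {H a b s t : ℝ} (hH0 : 0 < H) (hH1 : H < 1) (ha : 0 < a)
    (has : a ≤ s) (hsb : s ≤ b) (hat : a ≤ t) (htb : t ≤ b) :
    |t ^ H - s ^ H| ≤ (1 - a / b) ^ (1 - H) * |t - s| ^ H := by
  wlog hst : s ≤ t generalizing s t
  · rw [abs_sub_comm, abs_sub_comm t s]
    exact this hat htb has hsb (le_of_not_ge hst)
  have hs : 0 < s := ha.trans_le has
  have ht : 0 < t := ha.trans_le hat
  have hb : 0 < b := ht.trans_le htb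
  rw [abs_of_nonneg (sub_nonneg.2 (Real.rpow_le_rpow hs.le hst hH0.le)),
    abs_of_nonneg (sub_nonneg.2 hst)]
  have hu1 : s / t ≤ 1 := (div_le_one ht).2 hst
  have hu0 : 0 < s / t := div_pos hs ht
  have hab : a / b ≤ s / t := div_le_div₀ hs.le has ht htb
  have h1 : s / t ≤ (s / t) ^ H := by
    simpa using Real.rpow_le_rpow_of_exponent_ge hu0 hu1 hH1.le
  have h2 : t ^ H * (s / t) ^ H = s ^ H := by
    rw [← Real.mul_rpow ht.le hu0.le, mul_div_cancel₀ _ ht.ne']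
  have h3 : (1 - s / t) ^ (1 - H) ≤ (1 - a / b) ^ (1 - H) :=
    Real.rpow_le_rpow (by linarith) (by linarith) (by linarith)
  have h4 : (1 - s / t) = (1 - s / t) ^ (1 - H) * (1 - s / t) ^ H := by
    rw [← Real.rpow_add_of_nonneg (by linarith) (by linarith) hH0.le]; simp
  have h5 : t ^ H * (1 - s / t) ^ H = (t - s) ^ H := by
    rw [← Real.mul_rpow ht.le (by linarith)]; congr 1; field_simp
  have htH : 0 < t ^ H := Real.rpow_pos_of_pos ht H
  calc t ^ H - s ^ H = t ^ H * (1 - (s / t) ^ H) := by rw [mul_sub, h2, mul_one]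
    _ ≤ t ^ H * (1 - s / t) := by gcongr
    _ = (1 - s / t) ^ (1 - H) * (t - s) ^ H := by
      rw [← h5]; nth_rewrite 1 [h4]; ring
    _ ≤ _ := by gcongr

lemma rpow_two_mul_eq_sq {x : ℝ} (hx : 0 ≤ x) (H : ℝ) : x ^ (2 * H) = (x ^ H) ^ 2 := by
  rw [mul_comm, Real.rpow_mul hx]; norm_num

lemma fbmCov_eq {s t : ℝ} (hs : 0 ≤ s) (ht : 0 ≤ t) (H c : ℝ) :
    fbmCov H c s t = c / 2 * ((t ^ H) ^ 2 + (s ^ H) ^ 2 - (|t - s| ^ H) ^ 2) := by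
  rw [fbmCov, rpow_two_mul_eq_sq hs, rpow_two_mul_eq_sq ht, rpow_two_mul_eq_sq (abs_nonneg _)]

lemma fbmCov_self {H s : ℝ} (hH0 : 0 < H) (hs : 0 ≤ s) (c : ℝ) :
    fbmCov H c s s = c * (s ^ H) ^ 2 := by
  rw [fbmCov_eq hs hs]; simp [Real.zero_rpow hH0.ne']; ring

/-- Meant for `x = s ^ H`, `y = t ^ H`, `e = |t - s| ^ H`. The difference of the regression
coefficient from `1` is `(x² - y² + e²) / (2 x²)`, and `x² - y² = (x + y) (x - y)` is of first order
in `e`. -/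
lemma regression_bounds {x y e α β c : ℝ} (hc : 0 < c) (hα : 0 < α)
    (hxa : α ≤ x) (hxb : x ≤ β) (hya : α ≤ y) (hyb : y ≤ β) (he0 : 0 ≤ e)
    (hemax : e ≤ x ∨ e ≤ y) (hxye : |y - x| ≤ e) :
    |c / 2 * (y ^ 2 + x ^ 2 - e ^ 2) / (c * x ^ 2)| ≤ 3 * β ^ 2 / (2 * α ^ 2) ∧
    |1 - c / 2 * (y ^ 2 + x ^ 2 - e ^ 2) / (c * x ^ 2)| ≤ 3 * β / (2 * α ^ 2) * e := by
  have hx : 0 < x := by linarith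
  have hy : 0 < y := by linarith
  have hβ : 0 < β := by linarith
  have heβ : e ≤ β := by rcases hemax with h | h <;> linarith
  have hx2 : α ^ 2 ≤ x ^ 2 := pow_le_pow_left₀ hα.le hxa 2
  have hx2b : x ^ 2 ≤ β ^ 2 := pow_le_pow_left₀ hx.le hxb 2
  have hy2b : y ^ 2 ≤ β ^ 2 := pow_le_pow_left₀ hy.le hyb 2
  have he2b : e ^ 2 ≤ β ^ 2 := pow_le_pow_left₀ he0 heβ 2
  have hρ : c / 2 * (y ^ 2 + x ^ 2 - e ^ 2) / (c * x ^ 2) =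
      (y ^ 2 + x ^ 2 - e ^ 2) / (2 * x ^ 2) := by field_simp
  have hρ1 : 1 - (y ^ 2 + x ^ 2 - e ^ 2) / (2 * x ^ 2) =
      (x ^ 2 - y ^ 2 + e ^ 2) / (2 * x ^ 2) := by field_simp; ring
  rw [hρ, hρ1]
  constructor
  · rw [abs_div, abs_of_pos (by positivity : 0 < 2 * x ^ 2)]
    apply div_le_div₀ (by positivity) _ (by positivity) (by linarith)
    rw [abs_le]
    constructor <;> linarith [sq_nonneg x, sq_nonneg y, sq_nonneg e]
  · rw [abs_div, abs_of_pos (by positivity : 0 < 2 * x ^ 2), div_mul_eq_mul_div]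
    apply div_le_div₀ (by positivity) _ (by positivity) (by linarith)
    have h1 : |x ^ 2 - y ^ 2| ≤ 2 * β * e := by
      have : x ^ 2 - y ^ 2 = -((x + y) * (y - x)) := by ring
      rw [this, abs_neg, abs_mul, abs_of_pos (by linarith : 0 < x + y)]
      exact mul_le_mul (by linarith) hxye (abs_nonneg _) (by positivity)
    have h2 : |e ^ 2| ≤ β * e := by
      rw [abs_of_nonneg (sq_nonneg e), sq]; exact mul_le_mul_of_nonneg_right heβ he0
    linarith [abs_add_le (x ^ 2 - y ^ 2) (e ^ 2)]

/-- With `r` the correlation, `1 - r = (e² - (y - x)²) / (2 x y)`, which the gap `q² < 1` makes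
comparable to `e²`. Then `1 - r ≤ 1 - r² ≤ 2 (1 - r)` for `0 ≤ r ≤ 1`. -/
lemma correlation_bounds {x y e α β q c : ℝ} (hc : 0 < c) (hα : 0 < α) (hq1 : q ^ 2 < 1)
    (hxa : α ≤ x) (hxb : x ≤ β) (hya : α ≤ y) (hyb : y ≤ β) (he0 : 0 ≤ e)
    (hemax : e ≤ x ∨ e ≤ y) (hxy2 : (y - x) ^ 2 ≤ q ^ 2 * e ^ 2) :
    (c / 2 * (y ^ 2 + x ^ 2 - e ^ 2)) ^ 2 / (c * x ^ 2 * (c * y ^ 2)) ∈ Set.Icc 0 1 ∧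
    (1 - q ^ 2) / (2 * β ^ 2) * e ^ 2 ≤
      1 - (c / 2 * (y ^ 2 + x ^ 2 - e ^ 2)) ^ 2 / (c * x ^ 2 * (c * y ^ 2)) ∧
    1 - (c / 2 * (y ^ 2 + x ^ 2 - e ^ 2)) ^ 2 / (c * x ^ 2 * (c * y ^ 2)) ≤
      1 / α ^ 2 * e ^ 2 := by
  have hx : 0 < x := by linarith
  have hy : 0 < y := by linarith
  have hβ : 0 < β := by linarith
  set r := (y ^ 2 + x ^ 2 - e ^ 2) / (2 * (x * y)) with hr
  have hg : (c / 2 * (y ^ 2 + x ^ 2 - e ^ 2)) ^ 2 / (c * x ^ 2 * (c * y ^ 2)) = r ^ 2 := by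
    rw [hr]; field_simp
  have hr0 : 0 ≤ r := by
    apply div_nonneg _ (by positivity)
    rcases hemax with h | h
    · linarith [pow_le_pow_left₀ he0 h 2, sq_nonneg y]
    · linarith [pow_le_pow_left₀ he0 h 2, sq_nonneg x]
  have hr1 : 1 - r = (e ^ 2 - (y - x) ^ 2) / (2 * (x * y)) := by rw [hr]; field_simp; ring
  have hxyα : α ^ 2 ≤ x * y := by rw [sq]; exact mul_le_mul hxa hya hα.le hx.le
  have hxyβ : x * y ≤ β ^ 2 := by rw [sq]; exact mul_le_mul hxb hyb hy.le hβ.le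
  have hlow : (1 - q ^ 2) / (2 * β ^ 2) * e ^ 2 ≤ 1 - r := by
    rw [hr1, div_mul_eq_mul_div]
    have h0 : 0 ≤ (1 - q ^ 2) * e ^ 2 := mul_nonneg (by linarith) (sq_nonneg e)
    exact div_le_div₀ (by linarith) (by linarith) (by positivity) (by linarith)
  have hr1' : r ≤ 1 := by
    have : 0 ≤ (1 - q ^ 2) / (2 * β ^ 2) * e ^ 2 := by
      have : 0 ≤ 1 - q ^ 2 := by linarith
      positivity
    linarith
  have hup : 1 - r ≤ 1 / (2 * α ^ 2) * e ^ 2 := by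
    rw [hr1, div_mul_eq_mul_div]
    exact div_le_div₀ (by positivity) (by linarith [sq_nonneg (y - x)]) (by positivity)
      (by linarith)
  have hr2 : r ^ 2 ≤ r := by rw [sq]; exact mul_le_of_le_one_right hr0 hr1'
  have h2 : 1 / α ^ 2 * e ^ 2 = 2 * (1 / (2 * α ^ 2) * e ^ 2) := by field_simp
  rw [hg]
  exact ⟨⟨sq_nonneg _, by linarith⟩, by linarith, by nlinarith [sq_nonneg (1 - r)]⟩

/-- Bounds on the regression coefficient and the correlation of two values of a fractional
Brownian motion in terms of the distance of the two times. -/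
lemma exists_fbmCov_bounds {H c a b : ℝ} (hH0 : 0 < H) (hH1 : H < 1) (hc : 0 < c) (ha : 0 < a)
    (hab : a < b) :
    ∃ B k δ γ : ℝ, 1 ≤ B ∧ 0 < k ∧ 0 < δ ∧ 0 < γ ∧
      ∀ s ∈ Set.Icc a b, ∀ t ∈ Set.Icc a b,
        |fbmCov H c s t / fbmCov H c s s| ≤ B ∧
        |1 - fbmCov H c s t / fbmCov H c s s| ≤ k * |t - s| ^ H ∧
        fbmCov H c s t ^ 2 / (fbmCov H c s s * fbmCov H c t t) ∈ Set.Icc 0 1 ∧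
        δ * (|t - s| ^ H) ^ 2 ≤
          1 - fbmCov H c s t ^ 2 / (fbmCov H c s s * fbmCov H c t t) ∧
        1 - fbmCov H c s t ^ 2 / (fbmCov H c s s * fbmCov H c t t) ≤
          γ * (|t - s| ^ H) ^ 2 := by
  have hb : 0 < b := ha.trans hab
  set α := a ^ H with hα
  set β := b ^ H with hβ
  set q := (1 - a / b) ^ (1 - H) with hq
  have hα0 : 0 < α := Real.rpow_pos_of_pos ha H
  have hβ0 : 0 < β := Real.rpow_pos_of_pos hb H
  have hαβ : α ≤ β := Real.rpow_le_rpow ha.le hab.le hH0.le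
  have habd : 0 < a / b := div_pos ha hb
  have habd' : a / b < 1 := (div_lt_one hb).2 hab
  have hq0 : 0 ≤ q := Real.rpow_nonneg (by linarith) _
  have hq1 : q < 1 := Real.rpow_lt_one (by linarith) (by linarith) (by linarith)
  refine ⟨3 * β ^ 2 / (2 * α ^ 2), 3 * β / (2 * α ^ 2), (1 - q ^ 2) / (2 * β ^ 2), 1 / α ^ 2,
    ?_, by positivity, ?_, by positivity, ?_⟩
  · rw [le_div_iff₀ (by positivity)]; nlinarith
  · apply div_pos _ (by positivity); nlinarith
  rintro s ⟨has, hsb⟩ t ⟨hat, htb⟩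
  have hs : 0 < s := ha.trans_le has
  have ht : 0 < t := ha.trans_le hat
  have key := abs_rpow_sub_rpow_le hH0 hH1 ha has hsb hat htb
  rw [fbmCov_self hH0 hs.le, fbmCov_self hH0 ht.le, fbmCov_eq hs.le ht.le]
  have hxa : α ≤ s ^ H := Real.rpow_le_rpow ha.le has hH0.le
  have hxb : s ^ H ≤ β := Real.rpow_le_rpow hs.le hsb hH0.le
  have hya : α ≤ t ^ H := Real.rpow_le_rpow ha.le hat hH0.le
  have hyb : t ^ H ≤ β := Real.rpow_le_rpow ht.le htb hH0.le
  have he0 : 0 ≤ |t - s| ^ H := Real.rpow_nonneg (abs_nonneg _) H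
  have hemax : |t - s| ^ H ≤ s ^ H ∨ |t - s| ^ H ≤ t ^ H := by
    rcases le_total s t with h | h
    · right
      rw [abs_of_nonneg (sub_nonneg.2 h)]
      exact Real.rpow_le_rpow (sub_nonneg.2 h) (by linarith) hH0.le
    · left
      rw [abs_of_nonpos (sub_nonpos.2 h)]
      exact Real.rpow_le_rpow (by linarith) (by linarith) hH0.le
  have hq2 : q ^ 2 < 1 := by rw [sq]; exact mul_lt_one_of_nonneg_of_lt_one_left hq0 hq1 hq1.le
  obtain ⟨h1, h2⟩ := regression_bounds hc hα0 hxa hxb hya hyb he0 hemax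
    (key.trans (mul_le_of_le_one_left he0 hq1.le))
  refine ⟨h1, h2, correlation_bounds hc hα0 hq2 hxa hxb hya hyb he0 hemax ?_⟩
  rw [← sq_abs, ← mul_pow]
  exact pow_le_pow_left₀ (abs_nonneg _) key 2

/-- Telescoping: `1 - f i * p = (1 - f i) + f i * (1 - p)`. -/
lemma abs_one_sub_prod_le {ι : Type*} (S : Finset ι) (f : ι → ℝ) {B δ : ℝ} (hB : 1 ≤ B)
    (hδ : 0 ≤ δ) (hf : ∀ i ∈ S, |f i| ≤ B) (hf1 : ∀ i ∈ S, |1 - f i| ≤ δ) :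
    |1 - ∏ i ∈ S, f i| ≤ S.card * B ^ S.card * δ := by
  classical
  induction S using Finset.induction_on with
  | empty => simp
  | insert i S hi ih =>
    have ih := ih (fun j hj => hf j (Finset.mem_insert_of_mem hj))
      (fun j hj => hf1 j (Finset.mem_insert_of_mem hj))
    rw [Finset.prod_insert hi, Finset.card_insert_of_notMem hi]
    have h1 := hf i (Finset.mem_insert_self i S)
    have h2 := hf1 i (Finset.mem_insert_self i S)
    have hBn : 1 ≤ B ^ (S.card + 1) := one_le_pow₀ hB
    calc |1 - f i * ∏ j ∈ S, f j| = |(1 - f i) + f i * (1 - ∏ j ∈ S, f j)| := by ring_nf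
      _ ≤ |1 - f i| + |f i| * |1 - ∏ j ∈ S, f j| := by
        rw [← abs_mul]; exact abs_add_le _ _
      _ ≤ B ^ (S.card + 1) * δ + B * (S.card * B ^ S.card * δ) := by
        gcongr
        nlinarith
      _ = _ := by push_cast; ring

lemma Real.exists_norm_apply_eq {N : ℕ} (hN : 1 ≤ N) (x : Fin N → ℝ) : ∃ i, ‖x‖ = |x i| := by
  have : Nonempty (Fin N) := ⟨⟨0, hN⟩⟩
  obtain ⟨i, -, hi⟩ := Finset.exists_max_image Finset.univ (fun i => |x i|) Finset.univ_nonempty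
  exact ⟨i, le_antisymm ((pi_norm_le_iff_of_nonneg (abs_nonneg _)).2
    fun j => hi j (Finset.mem_univ j)) (norm_le_pi_norm x i)⟩

/-- Two-point bounds for the covariance of the fractional Brownian sheet on a cube: the conditional
variance is comparable to `‖t - s‖ ^ (2H)`, and the regression coefficient is within
`O(‖t - s‖ ^ H)` of `1`. -/
lemma exists_sheetCov_bounds {N : ℕ} (hN : 1 ≤ N) {H c a b : ℝ} (hH0 : 0 < H) (hH1 : H < 1)
    (hc : 0 < c) (ha : 0 < a) (hab : a < b) :
    ∃ v₀ v₁ κ : ℝ, 0 < v₀ ∧ 0 < v₁ ∧ 0 < κ ∧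
      ∀ s : Fin N → ℝ, (∀ i, s i ∈ Set.Icc a b) →
        v₀ ≤ ∏ i, fbmCov H c (s i) (s i) ∧ ∏ i, fbmCov H c (s i) (s i) ≤ v₁ ∧
        ∀ t : Fin N → ℝ, (∀ i, t i ∈ Set.Icc a b) →
        v₀ * (‖t - s‖ ^ H) ^ 2 ≤ (∏ i, fbmCov H c (t i) (t i)) -
          (∏ i, fbmCov H c (s i) (t i)) ^ 2 / ∏ i, fbmCov H c (s i) (s i) ∧
        (∏ i, fbmCov H c (t i) (t i)) -
          (∏ i, fbmCov H c (s i) (t i)) ^ 2 / (∏ i, fbmCov H c (s i) (s i)) ≤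
          v₁ * (‖t - s‖ ^ H) ^ 2 ∧
        |1 - (∏ i, fbmCov H c (s i) (t i)) / ∏ i, fbmCov H c (s i) (s i)| ≤ κ * ‖t - s‖ ^ H ∧
        |(∏ i, fbmCov H c (s i) (t i)) / ∏ i, fbmCov H c (s i) (s i)| ≤ κ := by
  obtain ⟨B, k, δ, γ, hB, hk, hδ, hγ, hbd⟩ := exists_fbmCov_bounds hH0 hH1 hc ha hab
  have hb : 0 < b := ha.trans hab
  set α := c * (a ^ H) ^ 2
  set β := c * (b ^ H) ^ 2
  have hα0 : 0 < α := mul_pos hc (pow_pos (Real.rpow_pos_of_pos ha H) 2)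
  have hβ0 : 0 < β := mul_pos hc (pow_pos (Real.rpow_pos_of_pos hb H) 2)
  have hself : ∀ s ∈ Set.Icc a b, α ≤ fbmCov H c s s ∧ fbmCov H c s s ≤ β := by
    rintro s ⟨has, hsb⟩
    have hs : 0 < s := ha.trans_le has
    rw [fbmCov_self hH0 hs.le]
    exact ⟨mul_le_mul_of_nonneg_left (pow_le_pow_left₀ (Real.rpow_nonneg ha.le H)
        (Real.rpow_le_rpow ha.le has hH0.le) 2) hc.le,
      mul_le_mul_of_nonneg_left (pow_le_pow_left₀ (Real.rpow_nonneg hs.le H)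
        (Real.rpow_le_rpow hs.le hsb hH0.le) 2) hc.le⟩
  -- `min` and `max` let one pair of constants bound both the variance (factor `1`) and the
  -- conditional variance (factors `δ` and `N * γ`).
  refine ⟨α ^ N * min 1 δ, β ^ N * max 1 (N * γ), max (N * B ^ N * k) (B ^ N), ?_, ?_, ?_, ?_⟩
  · have := lt_min one_pos hδ; positivity
  · have := lt_max_of_lt_left (c := N * γ) (one_pos (α := ℝ)); positivity
  · exact lt_max_of_lt_right (by positivity)
  intro s hs
  have hpL : ∀ s : Fin N → ℝ, (∀ i, s i ∈ Set.Icc a b) → α ^ N ≤ ∏ i, fbmCov H c (s i) (s i) := by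
    intro s hs
    calc α ^ N = ∏ _i : Fin N, α := by simp
      _ ≤ _ := Finset.prod_le_prod (fun _ _ => hα0.le) fun i _ => (hself _ (hs i)).1
  have hpU : ∀ s : Fin N → ℝ, (∀ i, s i ∈ Set.Icc a b) → ∏ i, fbmCov H c (s i) (s i) ≤ β ^ N := by
    intro s hs
    calc _ ≤ ∏ _i : Fin N, β := Finset.prod_le_prod
          (fun i _ => hα0.le.trans (hself _ (hs i)).1) fun i _ => (hself _ (hs i)).2
      _ = _ := by simp
  refine ⟨?_, ?_, ?_⟩
  · refine le_trans ?_ (hpL s hs)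
    exact mul_le_of_le_one_right (by positivity) (min_le_left _ _)
  · refine (hpU s hs).trans ?_
    exact le_mul_of_one_le_right (by positivity) (le_max_left _ _)
  intro t ht
  have he : ∀ i, |t i - s i| ^ H ≤ ‖t - s‖ ^ H := fun i =>
    Real.rpow_le_rpow (abs_nonneg _) (norm_le_pi_norm (t - s) i) hH0.le
  have hm0 : 0 ≤ ‖t - s‖ ^ H := Real.rpow_nonneg (norm_nonneg _) H
  have hps : 0 < ∏ i, fbmCov H c (s i) (s i) := (pow_pos hα0 N).trans_le (hpL s hs)
  have hpt : 0 < ∏ i, fbmCov H c (t i) (t i) := (pow_pos hα0 N).trans_le (hpL t ht)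
  -- The conditional variance is the variance times one minus the squared correlation, and the
  -- latter is a product over the parameters.
  have hτ : (∏ i, fbmCov H c (t i) (t i)) -
      (∏ i, fbmCov H c (s i) (t i)) ^ 2 / ∏ i, fbmCov H c (s i) (s i) =
      (∏ i, fbmCov H c (t i) (t i)) * (1 - ∏ i,
        fbmCov H c (s i) (t i) ^ 2 / (fbmCov H c (s i) (s i) * fbmCov H c (t i) (t i))) := by
    rw [Finset.prod_div_distrib, Finset.prod_mul_distrib, Finset.prod_pow]
    field_simp
  rw [hτ, ← Finset.prod_div_distrib]
  have hg : ∀ i, _ := fun i => (hbd (s i) (hs i) (t i) (ht i)).2.2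
  set g : Fin N → ℝ := fun i =>
    fbmCov H c (s i) (t i) ^ 2 / (fbmCov H c (s i) (s i) * fbmCov H c (t i) (t i)) with hgdef
  -- All factors lie in `[0, 1]`, so it suffices to look at the parameter where the sup norm of `t -
  -- s` is attained.
  have hgle : ∀ i, ∏ j, g j ≤ g i := fun i => by
    rw [← Finset.mul_prod_erase _ _ (Finset.mem_univ i)]
    exact mul_le_of_le_one_right (hg i).1.1
      (Finset.prod_le_one (fun j _ => (hg j).1.1) fun j _ => (hg j).1.2)
  have hle1 : min 1 δ * (‖t - s‖ ^ H) ^ 2 ≤ 1 - ∏ i, g i := by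
    obtain ⟨i, hi⟩ := Real.exists_norm_apply_eq hN (t - s)
    rw [hi]
    calc _ ≤ δ * (|t i - s i| ^ H) ^ 2 := mul_le_mul_of_nonneg_right (min_le_right _ _) (sq_nonneg _)
      _ ≤ 1 - g i := (hg i).2.1
      _ ≤ _ := by linarith [hgle i]
  have hle2 : 1 - ∏ i, g i ≤ N * γ * (‖t - s‖ ^ H) ^ 2 := by
    have := abs_one_sub_prod_le Finset.univ g (B := 1) (δ := γ * (‖t - s‖ ^ H) ^ 2) le_rfl
      (by positivity) (fun i _ => by rw [abs_of_nonneg (hg i).1.1]; exact (hg i).1.2)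
      (fun i _ => by
        rw [abs_of_nonneg (sub_nonneg.2 (hg i).1.2)]
        refine (hg i).2.2.trans ?_
        exact mul_le_mul_of_nonneg_left
          (pow_le_pow_left₀ (Real.rpow_nonneg (abs_nonneg _) _) (he i) 2) hγ.le)
    simp only [Finset.card_univ, Fintype.card_fin, one_pow, mul_one] at this
    calc _ ≤ _ := le_abs_self _
      _ ≤ _ := this
      _ = _ := by ring
  refine ⟨?_, ?_, ?_, ?_⟩
  · calc α ^ N * min 1 δ * (‖t - s‖ ^ H) ^ 2 = α ^ N * (min 1 δ * (‖t - s‖ ^ H) ^ 2) := by ring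
      _ ≤ _ := mul_le_mul (hpL t ht) hle1
        (by have := lt_min one_pos hδ; positivity) hpt.le
  · calc _ ≤ β ^ N * (max 1 (N * γ) * (‖t - s‖ ^ H) ^ 2) := by
          refine mul_le_mul (hpU t ht) (hle2.trans ?_) ?_ (by positivity)
          · gcongr; exact le_max_right _ _
          · refine le_trans ?_ hle1
            have := lt_min one_pos hδ; positivity
      _ = _ := by ring
  · have := abs_one_sub_prod_le Finset.univ (fun i => fbmCov H c (s i) (t i) /
      fbmCov H c (s i) (s i)) (B := B) (δ := k * ‖t - s‖ ^ H) hB (by positivity)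
      (fun i _ => (hbd _ (hs i) _ (ht i)).1)
      (fun i _ => (hbd _ (hs i) _ (ht i)).2.1.trans (mul_le_mul_of_nonneg_left (he i) hk.le))
    simp only [Finset.card_univ, Fintype.card_fin] at this
    calc _ ≤ _ := this
      _ = N * B ^ N * k * ‖t - s‖ ^ H := by ring
      _ ≤ _ := by gcongr; exact le_max_left _ _
  · rw [Finset.abs_prod]
    calc _ ≤ ∏ _i : Fin N, B := Finset.prod_le_prod (fun _ _ => abs_nonneg _)
          fun i _ => (hbd _ (hs i) _ (ht i)).1
      _ = B ^ N := by simp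
      _ ≤ _ := le_max_right _ _

/-! ### Small ball estimates for one and two Gaussian variables -/

lemma gaussianPDFReal_zero_le {v : ℝ≥0} (hv : 0 < v) (x : ℝ) :
    gaussianPDFReal 0 v x ≤ (√v)⁻¹ * Real.exp (-x ^ 2 / (2 * v)) := by
  rw [gaussianPDFReal, sub_zero]
  have hv' : (0 : ℝ) < v := hv
  gcongr
  nlinarith [Real.pi_gt_three]

lemma gaussianReal_Icc_le {v : ℝ≥0} (hv : 0 < v) {x ε K : ℝ} (hε : 0 ≤ ε)
    (hK : ∀ y ∈ Set.Icc (x - ε) (x + ε), gaussianPDFReal 0 v y ≤ K) :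
    gaussianReal 0 v (Set.Icc (x - ε) (x + ε)) ≤ ENNReal.ofReal (K * (2 * ε)) := by
  rw [gaussianReal_apply 0 hv.ne']
  have hK0 : 0 ≤ K := (gaussianPDFReal_nonneg 0 v x).trans (hK x ⟨by linarith, by linarith⟩)
  calc ∫⁻ y in Set.Icc (x - ε) (x + ε), gaussianPDF 0 v y
      ≤ ∫⁻ _ in Set.Icc (x - ε) (x + ε), ENNReal.ofReal K :=
        setLIntegral_mono measurable_const fun y hy => ENNReal.ofReal_le_ofReal (hK y hy)
    _ = ENNReal.ofReal (K * (2 * ε)) := by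
        rw [setLIntegral_const, Real.volume_Icc, ← ENNReal.ofReal_mul hK0]; ring_nf

lemma le_gaussianReal_Icc {v : ℝ≥0} (hv : 0 < v) {x ε K : ℝ} (hK0 : 0 ≤ K)
    (hK : ∀ y ∈ Set.Icc (x - ε) (x + ε), K ≤ gaussianPDFReal 0 v y) :
    ENNReal.ofReal (K * (2 * ε)) ≤ gaussianReal 0 v (Set.Icc (x - ε) (x + ε)) := by
  rw [gaussianReal_apply 0 hv.ne']
  calc ENNReal.ofReal (K * (2 * ε)) = ∫⁻ _ in Set.Icc (x - ε) (x + ε), ENNReal.ofReal K := by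
        rw [setLIntegral_const, Real.volume_Icc, ← ENNReal.ofReal_mul hK0]; ring_nf
    _ ≤ ∫⁻ y in Set.Icc (x - ε) (x + ε), gaussianPDF 0 v y :=
        setLIntegral_mono (measurable_gaussianPDF 0 v) fun y hy =>
          ENNReal.ofReal_le_ofReal (hK y hy)

lemma setOf_abs_sub_le_eq_preimage {Ω : Type*} (U : Ω → ℝ) (x ε : ℝ) :
    {ω | |U ω - x| ≤ ε} = U ⁻¹' Set.Icc (x - ε) (x + ε) := by
  ext ω
  simp only [Set.mem_ofPred_eq, Set.mem_preimage, Set.mem_Icc, abs_le]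
  constructor <;> rintro ⟨h1, h2⟩ <;> constructor <;> linarith

section
variable {Ω : Type*} [MeasurableSpace Ω] {P : Measure Ω}

lemma measure_abs_sub_le_eq_gaussianReal {U : Ω → ℝ} (hUm : Measurable U) (hU : HasGaussianLaw U P)
    (hU0 : P[U] = 0) (x ε : ℝ) :
    P {ω | |U ω - x| ≤ ε} =
      gaussianReal 0 Var[U; P].toNNReal (Set.Icc (x - ε) (x + ε)) := by
  rw [setOf_abs_sub_le_eq_preimage, ← Measure.map_apply hUm measurableSet_Icc,
    hU.map_eq_gaussianReal, hU0]

lemma measure_abs_sub_le_le {U : Ω → ℝ} (hUm : Measurable U) (hU : HasGaussianLaw U P)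
    (hU0 : P[U] = 0) {v : ℝ} (hv : 0 < v) (hvU : v ≤ Var[U; P]) (x : ℝ) {ε : ℝ} (hε : 0 ≤ ε) :
    P {ω | |U ω - x| ≤ ε} ≤ ENNReal.ofReal ((√v)⁻¹ * (2 * ε)) := by
  rw [measure_abs_sub_le_eq_gaussianReal hUm hU hU0]
  have hv' : 0 < Var[U; P].toNNReal := Real.toNNReal_pos.2 (hv.trans_le hvU)
  refine gaussianReal_Icc_le hv' hε fun y _ => (gaussianPDFReal_zero_le hv' y).trans ?_
  have h1 : Real.exp (-y ^ 2 / (2 * (Var[U; P].toNNReal : ℝ))) ≤ 1 :=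
    Real.exp_le_one_iff.2 (div_nonpos_of_nonpos_of_nonneg (by nlinarith) (by positivity))
  rw [Real.coe_toNNReal _ (hv.trans_le hvU).le] at *
  calc _ ≤ (√v)⁻¹ * 1 := by gcongr
    _ = _ := mul_one _

/-- The condition `w + ε ≤ |x|` keeps the whole interval at distance at least `w` from the origin,
where the density has its Gaussian decay. -/
lemma measure_abs_sub_le_le_exp {U : Ω → ℝ} (hUm : Measurable U) (hU : HasGaussianLaw U P)
    (hU0 : P[U] = 0) {v v' : ℝ} (hv : 0 < v) (hvU : v ≤ Var[U; P]) (hUv' : Var[U; P] ≤ v')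
    {x w ε : ℝ} (hε : 0 ≤ ε) (hw : 0 ≤ w) (hx : w + ε ≤ |x|) :
    P {ω | |U ω - x| ≤ ε} ≤
      ENNReal.ofReal ((√v)⁻¹ * Real.exp (-(w ^ 2 / (2 * v'))) * (2 * ε)) := by
  rw [measure_abs_sub_le_eq_gaussianReal hUm hU hU0]
  have hV : 0 < Var[U; P] := hv.trans_le hvU
  have hv' : 0 < Var[U; P].toNNReal := Real.toNNReal_pos.2 hV
  refine gaussianReal_Icc_le hv' hε fun y hy => (gaussianPDFReal_zero_le hv' y).trans ?_
  rw [Real.coe_toNNReal _ hV.le, neg_div]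
  have hwy : w ≤ |y| := by
    have h1 : |x - y| ≤ ε := abs_le.2 ⟨by linarith [hy.2], by linarith [hy.1]⟩
    linarith [abs_sub_abs_le_abs_sub x y]
  have : w ^ 2 ≤ y ^ 2 := by rw [← sq_abs y]; exact pow_le_pow_left₀ hw hwy 2
  gcongr

lemma le_measure_abs_sub_le {U : Ω → ℝ} (hUm : Measurable U) (hU : HasGaussianLaw U P)
    (hU0 : P[U] = 0) {v v' M : ℝ} (hv : 0 < v) (hvU : v ≤ Var[U; P]) (hUv' : Var[U; P] ≤ v')
    {x ε : ℝ} (hM : |x| + ε ≤ M) :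
    ENNReal.ofReal ((√(2 * Real.pi * v'))⁻¹ * Real.exp (-(M ^ 2 / (2 * v))) * (2 * ε)) ≤
      P {ω | |U ω - x| ≤ ε} := by
  rw [measure_abs_sub_le_eq_gaussianReal hUm hU hU0]
  have hV : 0 < Var[U; P] := hv.trans_le hvU
  have hv' : 0 < Var[U; P].toNNReal := Real.toNNReal_pos.2 hV
  refine le_gaussianReal_Icc hv' (by positivity) fun y hy => ?_
  have hyM : |y| ≤ M := by
    have h1 : |y - x| ≤ ε := abs_le.2 ⟨by linarith [hy.1], by linarith [hy.2]⟩
    linarith [abs_sub_abs_le_abs_sub y x]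
  have : y ^ 2 ≤ M ^ 2 := by rw [← sq_abs y]; exact pow_le_pow_left₀ (abs_nonneg y) hyM 2
  rw [gaussianPDFReal, sub_zero, Real.coe_toNNReal _ hV.le, neg_div]
  gcongr

/-- Trades Gaussian decay for the power `d`, via `y ^ d / d! ≤ exp y`. This power is what later
turns `σ ^ (-d)` into `‖x - y‖ ^ (-d)`. -/
lemma exp_neg_mul_sq_le {l u : ℝ} (hl : 0 < l) (hu : 0 < u) (d : ℕ) :
    Real.exp (-(l * u ^ 2)) ≤ (1 + d.factorial / l ^ d) * (u⁻¹) ^ d := by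
  have h1 := Real.pow_div_factorial_le_exp (l * u ^ 2) (by positivity) d
  set E := Real.exp (l * u ^ 2) with hE
  have hE1 : 1 ≤ E := Real.one_le_exp (by positivity)
  have h2 : (u ^ d) ^ 2 ≤ d.factorial / l ^ d * E := by
    rw [div_le_iff₀ (by positivity)] at h1
    rw [div_mul_eq_mul_div, le_div_iff₀ (by positivity)]
    calc (u ^ d) ^ 2 * l ^ d = (l * u ^ 2) ^ d := by rw [mul_pow, ← pow_mul, ← pow_mul]; ring
      _ ≤ _ := by linarith
  have hK : 0 ≤ (d.factorial : ℝ) / l ^ d := by positivity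
  have hud : 0 < u ^ d := by positivity
  have h3 : u ^ d ≤ (1 + d.factorial / l ^ d) * E := by
    by_cases h : u ^ d ≤ 1
    · nlinarith
    · nlinarith
  rw [Real.exp_neg, ← hE, inv_pow, inv_eq_one_div E, div_le_iff₀ (by positivity)]
  rw [mul_assoc, mul_comm _ E, ← mul_assoc, ← div_eq_mul_inv, le_div_iff₀ hud, one_mul]
  exact h3

/-- The regression residual of jointly Gaussian variables. -/
lemma gaussian_residual [IsProbabilityMeasure P] {U V : Ω → ℝ}
    (hUV : HasGaussianLaw (fun ω => (U ω, V ω)) P) (hU : P[U] = 0) (hV : P[V] = 0)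
    (hpos : 0 < Var[U; P]) :
    HasGaussianLaw (fun ω => V ω - cov[U, V; P] / Var[U; P] * U ω) P ∧
    P[fun ω => V ω - cov[U, V; P] / Var[U; P] * U ω] = 0 ∧
    Var[fun ω => V ω - cov[U, V; P] / Var[U; P] * U ω; P] =
      Var[V; P] - cov[U, V; P] ^ 2 / Var[U; P] ∧
    IndepFun U (fun ω => V ω - cov[U, V; P] / Var[U; P] * U ω) P := by
  set ρ := cov[U, V; P] / Var[U; P] with hρ
  have hU2 : MemLp U 2 P := hUV.fst.memLp_two
  have hV2 : MemLp V 2 P := hUV.snd.memLp_two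
  have hρU2 : MemLp (fun ω => ρ * U ω) 2 P := hU2.const_mul ρ
  have hpair : HasGaussianLaw (fun ω => (U ω, V ω - ρ * U ω)) P := by
    have := hUV.map_fun ((ContinuousLinearMap.fst ℝ ℝ ℝ).prod
      (ContinuousLinearMap.snd ℝ ℝ ℝ - ρ • ContinuousLinearMap.fst ℝ ℝ ℝ))
    simpa using this
  have hUU : cov[U, U; P] = Var[U; P] := covariance_self hUV.fst.aemeasurable
  refine ⟨hpair.snd, ?_, ?_, ?_⟩
  · rw [integral_sub (hV2.integrable (by norm_num)) (hρU2.integrable (by norm_num)),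
      integral_const_mul, hU, hV]; simp
  · rw [← covariance_self hpair.snd.aemeasurable,
      covariance_fun_sub_fun_sub hV2 hρU2 hV2 hρU2, covariance_self hUV.snd.aemeasurable,
      covariance_const_mul_right, covariance_const_mul_left, covariance_const_mul_left,
      covariance_const_mul_right, hUU, covariance_comm V U, hρ]
    field_simp; ring
  · apply hpair.indepFun_of_covariance_eq_zero
    rw [covariance_fun_sub_right hU2 hV2 hρU2, covariance_const_mul_right, hUU, hρ]
    field_simp; ring

/-- Small ball estimates for a pair of centered jointly Gaussian variables with conditional
standard deviation of order `σ`. -/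
lemma measure_gaussian_pair_le [IsProbabilityMeasure P] {U V : Ω → ℝ} (hUm : Measurable U)
    (hVm : Measurable V)
    (hUV : HasGaussianLaw (fun ω => (U ω, V ω)) P) (hU : P[U] = 0) (hV : P[V] = 0)
    {v₀ v₁ κ σ M D : ℝ} (hv₀ : 0 < v₀) (hv₁ : 0 < v₁) (hκ : 0 < κ) (hσ : 0 < σ) (hM : 0 < M)
    (hD : 0 < D) (d : ℕ)
    (hvar : v₀ ≤ Var[U; P])
    (hτ₀ : v₀ * σ ^ 2 ≤ Var[V; P] - cov[U, V; P] ^ 2 / Var[U; P])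
    (hτ₁ : Var[V; P] - cov[U, V; P] ^ 2 / Var[U; P] ≤ v₁ * σ ^ 2)
    (hρ₁ : |1 - cov[U, V; P] / Var[U; P]| ≤ κ * σ) (hρ : |cov[U, V; P] / Var[U; P]| ≤ κ)
    {x y ε : ℝ} (hε : 0 < ε) (hx : |x| ≤ M) :
    P {ω | |U ω - x| ≤ ε ∧ |V ω - y| ≤ ε} ≤ ENNReal.ofReal ((√v₀)⁻¹ * (2 * ε)) ∧
    P {ω | |U ω - x| ≤ ε ∧ |V ω - y| ≤ ε} ≤
      ENNReal.ofReal (4 * (1 + κ) * v₀⁻¹ * (ε ^ 2 / σ)) ∧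
    ∀ z, 0 < z → 4 * D * (1 + κ) * ε ≤ z → z ≤ D * |x - y| →
      P {ω | |U ω - x| ≤ ε ∧ |V ω - y| ≤ ε} ≤
      ENNReal.ofReal (4 * (1 + κ) * v₀⁻¹ *
        (1 + d.factorial / (1 / (8 * D ^ 2 * v₁)) ^ d + (4 * D * κ * M) ^ d) *
        (ε ^ 2 / σ * (σ / z) ^ d)) := by
  obtain ⟨hW, hW0, hWv, hind⟩ := gaussian_residual hUV hU hV (hv₀.trans_le hvar)
  rw [← hWv] at hτ₀ hτ₁
  set ρ := cov[U, V; P] / Var[U; P] with hρdef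
  set W : Ω → ℝ := fun ω => V ω - ρ * U ω with hWdef
  have hWm : Measurable W := hVm.sub (hUm.const_mul ρ)
  have hv₀σ : 0 < v₀ * σ ^ 2 := by positivity
  have h1 : P {ω | |U ω - x| ≤ ε} ≤ ENNReal.ofReal ((√v₀)⁻¹ * (2 * ε)) :=
    measure_abs_sub_le_le hUm hUV.fst hU hv₀ hvar x hε.le
  -- The event forces the residual `W = V - ρ U` to be within `(1 + κ) ε` of `y - ρ x`, and `W` is
  -- independent of `U`.
  have hprod : P {ω | |U ω - x| ≤ ε ∧ |V ω - y| ≤ ε} ≤ ENNReal.ofReal ((√v₀)⁻¹ * (2 * ε)) *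
      P {ω | |W ω - (y - ρ * x)| ≤ (1 + κ) * ε} := by
    calc P {ω | |U ω - x| ≤ ε ∧ |V ω - y| ≤ ε}
        ≤ P ({ω | |U ω - x| ≤ ε} ∩ {ω | |W ω - (y - ρ * x)| ≤ (1 + κ) * ε}) := by
          refine measure_mono fun ω hω => ⟨hω.1, ?_⟩
          have : W ω - (y - ρ * x) = (V ω - y) - ρ * (U ω - x) := by simp only [hWdef]; ring
          rw [Set.mem_ofPred_eq, this]
          calc _ ≤ |V ω - y| + |ρ * (U ω - x)| := abs_sub _ _
            _ ≤ ε + κ * ε := by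
              rw [abs_mul]
              exact add_le_add hω.2 (mul_le_mul hρ hω.1 (abs_nonneg _) hκ.le)
            _ = _ := by ring
      _ = P {ω | |U ω - x| ≤ ε} * P {ω | |W ω - (y - ρ * x)| ≤ (1 + κ) * ε} := by
          rw [setOf_abs_sub_le_eq_preimage, setOf_abs_sub_le_eq_preimage]
          exact hind.measure_inter_preimage_eq_mul _ _ measurableSet_Icc measurableSet_Icc
      _ ≤ _ := by gcongr
  have hs0 : 0 < √v₀ := Real.sqrt_pos.2 hv₀
  have hsq : √(v₀ * σ ^ 2) = √v₀ * σ := by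
    rw [Real.sqrt_mul hv₀.le, Real.sqrt_sq hσ.le]
  have hss : √v₀ * √v₀ = v₀ := Real.mul_self_sqrt hv₀.le
  have hinv : (√v₀)⁻¹ * (√v₀)⁻¹ = v₀⁻¹ := by rw [← mul_inv, hss]
  have hκε : 0 ≤ (1 + κ) * ε := by positivity
  have h2 : P {ω | |U ω - x| ≤ ε ∧ |V ω - y| ≤ ε} ≤
      ENNReal.ofReal (4 * (1 + κ) * v₀⁻¹ * (ε ^ 2 / σ)) := by
    have := measure_abs_sub_le_le hWm hW hW0 hv₀σ hτ₀ (y - ρ * x) hκε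
    refine hprod.trans ((mul_le_mul_right this _).trans ?_)
    rw [← ENNReal.ofReal_mul (by positivity), hsq, mul_inv, ← hinv]
    apply le_of_eq; congr 1; field_simp; ring
  refine ⟨(measure_mono fun ω hω => hω.1).trans h1, h2, fun z hz hεz hzxy => ?_⟩
  -- If `z` is large compared with `σ`, the drift `|1 - ρ| |x| ≤ κ σ M` cannot account for the
  -- separation `z / D`, so `W` is in its Gaussian tail. Otherwise `σ / z` is bounded below and the
  -- estimate without decay suffices.
  by_cases hcase : 4 * D * κ * M * σ ≤ z
  · have hsep : z / (2 * D) + (1 + κ) * ε ≤ |y - ρ * x| := by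
      have e1 : |x - y| ≤ |y - ρ * x| + κ * σ * M := by
        have : x - y = -(y - ρ * x) + (1 - ρ) * x := by ring
        rw [this]
        refine (abs_add_le _ _).trans ?_
        rw [abs_neg, abs_mul]
        gcongr
      have e2 : z / D ≤ |x - y| := by rw [div_le_iff₀ hD]; linarith
      have e3 : κ * σ * M ≤ z / D / 4 := by
        rw [div_div, le_div_iff₀ (by positivity)]; linarith
      have e4 : (1 + κ) * ε ≤ z / D / 4 := by
        rw [div_div, le_div_iff₀ (by positivity)]; linarith
      have e5 : z / (2 * D) = z / D / 2 := by field_simp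
      linarith
    have := measure_abs_sub_le_le_exp hWm hW hW0 hv₀σ hτ₀ hτ₁ hκε (by positivity) hsep
    refine hprod.trans ((mul_le_mul_right this _).trans ?_)
    rw [← ENNReal.ofReal_mul (by positivity)]
    apply ENNReal.ofReal_le_ofReal
    have hexp := exp_neg_mul_sq_le (l := 1 / (8 * D ^ 2 * v₁)) (u := z / σ) (by positivity)
      (by positivity) d
    have harg : (z / (2 * D)) ^ 2 / (2 * (v₁ * σ ^ 2)) =
      1 / (8 * D ^ 2 * v₁) * (z / σ) ^ 2 := by field_simp; ring
    rw [harg, hsq]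
    rw [inv_div] at hexp
    calc _ = 4 * (1 + κ) * ((√v₀)⁻¹ * (√v₀)⁻¹) * (ε ^ 2 / σ) *
          Real.exp (-(1 / (8 * D ^ 2 * v₁) * (z / σ) ^ 2)) := by field_simp; ring
      _ ≤ 4 * (1 + κ) * v₀⁻¹ * (ε ^ 2 / σ) *
          ((1 + d.factorial / (1 / (8 * D ^ 2 * v₁)) ^ d + (4 * D * κ * M) ^ d) *
            (σ / z) ^ d) := by
          rw [hinv]
          gcongr
          exact hexp.trans (mul_le_mul_of_nonneg_right
            (le_add_of_nonneg_right (by positivity)) (by positivity))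
      _ = _ := by ring
  · refine h2.trans (ENNReal.ofReal_le_ofReal ?_)
    have h3 : 1 ≤ (4 * D * κ * M) ^ d * (σ / z) ^ d := by
      rw [← mul_pow]
      apply one_le_pow₀
      rw [← mul_div_assoc, le_div_iff₀ hz]; linarith
    have h4 : (4 * D * κ * M) ^ d * (σ / z) ^ d ≤
        (1 + d.factorial / (1 / (8 * D ^ 2 * v₁)) ^ d + (4 * D * κ * M) ^ d) * (σ / z) ^ d := by
      gcongr
      have : 0 ≤ d.factorial / (1 / (8 * D ^ 2 * v₁)) ^ d := by positivity
      linarith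
    calc _ = 4 * (1 + κ) * v₀⁻¹ * (ε ^ 2 / σ) * 1 := by ring
      _ ≤ 4 * (1 + κ) * v₀⁻¹ * (ε ^ 2 / σ) *
          ((1 + d.factorial / (1 / (8 * D ^ 2 * v₁)) ^ d + (4 * D * κ * M) ^ d) *
            (σ / z) ^ d) := by
          gcongr; exact h3.trans h4
      _ = _ := by ring

end

/-! ### One-point and two-point estimates for the sheet -/

lemma EuclideanSpace.exists_norm_le_mul_abs {d : ℕ} (hd : 1 ≤ d) (z : EuclideanSpace ℝ (Fin d)) :
    ∃ j, ‖z‖ ≤ d * |z j| := by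
  have : Nonempty (Fin d) := ⟨⟨0, hd⟩⟩
  obtain ⟨j, -, hj⟩ := Finset.exists_max_image Finset.univ (fun j => |z j|) Finset.univ_nonempty
  refine ⟨j, abs_le_of_sq_le_sq' ?_ (by positivity) |>.2⟩
  rw [EuclideanSpace.norm_sq_eq]
  have hd1 : (1 : ℝ) ≤ d := by exact_mod_cast hd
  calc ∑ i, ‖z i‖ ^ 2 ≤ ∑ _i : Fin d, |z j| ^ 2 :=
        Finset.sum_le_sum fun i hi => pow_le_pow_left₀ (norm_nonneg _) (hj i hi) 2
    _ = d * |z j| ^ 2 := by simp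
    _ ≤ (d * |z j|) ^ 2 := by rw [mul_pow]; gcongr; nlinarith

namespace IsFractionalBrownianSheet

variable {N d : ℕ} {Ω : Type*} [MeasurableSpace Ω] {H c : ℝ} {P : Measure Ω}
  {X : (Fin N → ℝ≥0) → Ω → EuclideanSpace ℝ (Fin d)}

lemma measurable_coord (hX : IsFractionalBrownianSheet H c X P) (t : Fin N → ℝ≥0) (j : Fin d) :
    Measurable fun ω => X t ω j :=
  (EuclideanSpace.proj (𝕜 := ℝ) j).continuous.measurable.comp (hX.measurable t)

lemma hasGaussianLaw_pair (hX : IsFractionalBrownianSheet H c X P) (s t : Fin N → ℝ≥0)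
    (j : Fin d) : HasGaussianLaw (fun ω => (X s ω j, X t ω j)) P := by
  have := (hX.gaussian.hasGaussianLaw_prodMk (s := s) (t := t)).map_fun
    (((EuclideanSpace.proj (𝕜 := ℝ) j).comp (ContinuousLinearMap.fst ℝ _ _)).prod
      ((EuclideanSpace.proj (𝕜 := ℝ) j).comp (ContinuousLinearMap.snd ℝ _ _)))
  simpa using this

lemma covariance_coord [IsProbabilityMeasure P] (hX : IsFractionalBrownianSheet H c X P)
    (s t : Fin N → ℝ≥0) (j : Fin d) :
    cov[fun ω => X s ω j, fun ω => X t ω j; P] = ∏ i, fbmCov H c (s i) (t i) := by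
  have hp := hX.hasGaussianLaw_pair s t j
  rw [covariance_eq_sub hp.fst.memLp_two hp.snd.memLp_two, hX.centered, zero_mul, sub_zero,
    mul_comm]
  exact hX.covariance s t j

lemma variance_coord [IsProbabilityMeasure P] (hX : IsFractionalBrownianSheet H c X P)
    (s : Fin N → ℝ≥0) (j : Fin d) :
    Var[fun ω => X s ω j; P] = ∏ i, fbmCov H c (s i) (s i) := by
  rw [← covariance_self (hX.measurable_coord s j).aemeasurable, hX.covariance_coord]

/-- Independence of whole coordinate paths lets each event `S j` involve several times at once. -/
lemma measure_forall_eq_prod (hX : IsFractionalBrownianSheet H c X P)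
    {S : Fin d → Set ((Fin N → ℝ≥0) → ℝ)} (hS : ∀ j, MeasurableSet (S j)) :
    P {ω | ∀ j, (fun t => X t ω j) ∈ S j} = ∏ j, P {ω | (fun t => X t ω j) ∈ S j} := by
  have := hX.indep.measure_inter_preimage_eq_mul Finset.univ (sets := S) fun j _ => hS j
  rw [show {ω | ∀ j, (fun t => X t ω j) ∈ S j} =
    ⋂ j ∈ Finset.univ, (fun ω t => X t ω j) ⁻¹' S j by ext ω; simp]
  exact this

end IsFractionalBrownianSheet

lemma prod_le_ofReal_pow_of_forall {ι : Type*} [Fintype ι] {q : ι → ℝ≥0∞} {x : ℝ}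
    (hq : ∀ i, q i ≤ ENNReal.ofReal x) : ∏ i, q i ≤ ENNReal.ofReal x ^ Fintype.card ι := by
  calc ∏ i, q i ≤ ∏ _i : ι, ENNReal.ofReal x := Finset.prod_le_prod' fun i _ => hq i
    _ = _ := by simp

/-- Two-point small ball estimate for the fractional Brownian sheet. -/
lemma exists_measure_two_point_le {N d : ℕ} (hN : 1 ≤ N) (hd : 1 ≤ d) {H c a b M : ℝ}
    (hH0 : 0 < H) (hH1 : H < 1) (hc : 0 < c) (ha : 0 < a) (hab : a < b) (hM : 0 < M) :
    ∃ K : ℝ, 0 < K ∧ ∀ (Ω : Type*) [MeasurableSpace Ω] (P : Measure Ω) [IsProbabilityMeasure P]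
      (X : (Fin N → ℝ≥0) → Ω → EuclideanSpace ℝ (Fin d)), IsFractionalBrownianSheet H c X P →
      ∀ s t : Fin N → ℝ≥0, (∀ i, (s i : ℝ) ∈ Set.Icc a b) → (∀ i, (t i : ℝ) ∈ Set.Icc a b) →
      s ≠ t → ∀ x y : EuclideanSpace ℝ (Fin d), ‖x‖ ≤ M → ∀ ε : ℝ, 0 < ε →
      P {ω | (∀ j, |X s ω j - x j| ≤ ε) ∧ ∀ j, |X t ω j - y j| ≤ ε} ≤
        ENNReal.ofReal (K * (ε ^ 2 /
          max (‖(fun i => (t i : ℝ)) - fun i => (s i : ℝ)‖ ^ H) ‖x - y‖)) ^ d := by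
  obtain ⟨v₀, v₁, κ, hv₀, hv₁, hκ, hbd⟩ := exists_sheetCov_bounds hN hH0 hH1 hc ha hab
  have hd0 : (0 : ℝ) < d := by exact_mod_cast hd
  set K₀ := (√v₀)⁻¹ * 2
  set K₁ := 4 * (1 + κ) * v₀⁻¹
  set L := 1 + d.factorial / (1 / (8 * (d : ℝ) ^ 2 * v₁)) ^ d + (4 * d * κ * M) ^ d
  set C₁ := 4 * (d : ℝ) * (1 + κ)
  have hK₀ : 0 < K₀ := mul_pos (inv_pos.2 (Real.sqrt_pos.2 hv₀)) two_pos
  have hK₁ : 0 < K₁ := by positivity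
  have hL : 1 ≤ L := by
    have : 0 ≤ d.factorial / (1 / (8 * (d : ℝ) ^ 2 * v₁)) ^ d + (4 * d * κ * M) ^ d := by
      positivity
    simp only [L]; linarith
  have hC₁ : 0 < C₁ := by positivity
  refine ⟨K₁ * L + K₀ * C₁, by positivity, ?_⟩
  intro Ω _ P _ X hX s t hs ht hst x y hx ε hε
  set K := K₁ * L + K₀ * C₁
  have hK1 : K₁ ≤ K := by
    have : K₁ ≤ K₁ * L := le_mul_of_one_le_right hK₁.le hL
    have : 0 < K₀ * C₁ := by positivity
    simp only [K]; linarith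
  have hK2 : K₁ * L ≤ K := by
    have : 0 < K₀ * C₁ := by positivity
    simp only [K]; linarith
  have hK3 : K₀ * C₁ ≤ K := by
    have : 0 < K₁ * L := by positivity
    simp only [K]; linarith
  have hK : 0 < K := by positivity
  set σ := ‖(fun i => (t i : ℝ)) - fun i => (s i : ℝ)‖ ^ H
  have hσ : 0 < σ := by
    refine Real.rpow_pos_of_pos (norm_pos_iff.2 (sub_ne_zero.2 fun h => hst ?_)) H
    ext i; exact (congrFun h i).symm
  obtain ⟨hb1, hb2, hb3⟩ := hbd (fun i => s i) hs
  obtain ⟨hb4, hb5, hb6, hb7⟩ := hb3 (fun i => t i) ht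
  set q : Fin d → ℝ≥0∞ := fun j => P {ω | |X s ω j - x j| ≤ ε ∧ |X t ω j - y j| ≤ ε}
  have hq : ∀ j, q j ≤ ENNReal.ofReal ((√v₀)⁻¹ * (2 * ε)) ∧ q j ≤ ENNReal.ofReal (K₁ * (ε ^ 2 / σ))
      ∧ ∀ z, 0 < z → C₁ * ε ≤ z → z ≤ d * |x j - y j| →
        q j ≤ ENNReal.ofReal (K₁ * L * (ε ^ 2 / σ * (σ / z) ^ d)) := by
    intro j
    refine measure_gaussian_pair_le (P := P) (hX.measurable_coord s j) (hX.measurable_coord t j)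
      (hX.hasGaussianLaw_pair s t j) (hX.centered s j) (hX.centered t j) hv₀ hv₁ hκ hσ hM hd0 d
      ?_ ?_ ?_ ?_ ?_ hε ((PiLp.norm_apply_le x j).trans hx) <;>
    simp only [hX.variance_coord, hX.covariance_coord] <;> assumption
  have hprod : P {ω | (∀ j, |X s ω j - x j| ≤ ε) ∧ ∀ j, |X t ω j - y j| ≤ ε} = ∏ j, q j := by
    refine Eq.trans ?_ (hX.measure_forall_eq_prod
      (S := fun j => {f | |f s - x j| ≤ ε ∧ |f t - y j| ≤ ε}) ?_)
    · congr 1; ext ω; exact forall_and.symm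
    · intro j
      exact (measurableSet_le (f := fun f : (Fin N → ℝ≥0) → ℝ => |f s - x j|) (by fun_prop)
        measurable_const).inter (measurableSet_le (f := fun f : (Fin N → ℝ≥0) → ℝ => |f t - y j|)
        (by fun_prop) measurable_const)
  rw [hprod]
  -- Three regimes: `‖x - y‖ ≤ σ`, where each coordinate contributes `ε² / σ`; `‖x - y‖` large
  -- against both `σ` and `ε`; and `σ < ‖x - y‖ < C₁ ε`.
  rcases le_or_gt ‖x - y‖ σ with h | h
  · rw [max_eq_left h]
    refine (prod_le_ofReal_pow_of_forall fun j => (hq j).2.1.trans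
      (ENNReal.ofReal_le_ofReal (?_ : _ ≤ K * (ε ^ 2 / σ)))).trans_eq (by simp)
    gcongr
  have hz : 0 < ‖x - y‖ := hσ.trans h
  rw [max_eq_right h.le]
  rcases le_or_gt (C₁ * ε) ‖x - y‖ with h' | h'
  -- Only one coordinate is sure to be separated, so its factor must supply the full gain `(σ / ‖x -
  -- y‖) ^ d`; the others keep `ε² / σ`.
  · obtain ⟨j, hj⟩ := EuclideanSpace.exists_norm_le_mul_abs hd (x - y)
    have h1 := (hq j).2.2 _ hz h' hj
    calc ∏ j, q j = q j * ∏ i ∈ Finset.univ.erase j, q i :=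
          (Finset.mul_prod_erase _ _ (Finset.mem_univ j)).symm
      _ ≤ ENNReal.ofReal (K * (ε ^ 2 / σ * (σ / ‖x - y‖) ^ d)) *
          ∏ _i ∈ Finset.univ.erase j, ENNReal.ofReal (K * (ε ^ 2 / σ)) := by
        refine mul_le_mul' (h1.trans (ENNReal.ofReal_le_ofReal (by gcongr)))
          (Finset.prod_le_prod' fun i _ => (hq i).2.1.trans (ENNReal.ofReal_le_ofReal ?_))
        gcongr
      _ = ENNReal.ofReal (K * (ε ^ 2 / ‖x - y‖)) ^ d := by
        obtain ⟨n, rfl⟩ : ∃ n, d = n + 1 := ⟨d - 1, by omega⟩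
        rw [Finset.prod_const, Finset.card_erase_of_mem (Finset.mem_univ j)]
        simp only [Finset.card_univ, Fintype.card_fin, Nat.add_sub_cancel]
        rw [← ENNReal.ofReal_pow (by positivity), ← ENNReal.ofReal_pow (by positivity),
          ← ENNReal.ofReal_mul (by positivity)]
        congr 1
        have : ε ^ 2 / ‖x - y‖ = ε ^ 2 / σ * (σ / ‖x - y‖) := by field_simp
        rw [this]; ring_nf
  -- Here `ε ≤ C₁ ε² / ‖x - y‖`, so the constraint at time `s` alone is enough.
  · refine (prod_le_ofReal_pow_of_forall fun j => (hq j).1.trans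
      (ENNReal.ofReal_le_ofReal (?_ : _ ≤ K * (ε ^ 2 / ‖x - y‖)))).trans_eq (by simp)
    calc (√v₀)⁻¹ * (2 * ε) = K₀ * ε := (mul_assoc _ _ _).symm
      _ ≤ K₀ * C₁ * (ε ^ 2 / ‖x - y‖) := by
        rw [mul_assoc K₀]
        refine mul_le_mul_of_nonneg_left ?_ hK₀.le
        rw [← mul_div_assoc, le_div_iff₀ hz]; nlinarith
      _ ≤ _ := by gcongr

/-- One-point small ball estimate from below for the fractional Brownian sheet. -/
lemma exists_le_measure_one_point {N d : ℕ} (hN : 1 ≤ N) {H c a b M : ℝ}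
    (hH0 : 0 < H) (hH1 : H < 1) (hc : 0 < c) (ha : 0 < a) (hab : a < b) :
    ∃ K : ℝ, 0 < K ∧ ∀ (Ω : Type*) [MeasurableSpace Ω] (P : Measure Ω) [IsProbabilityMeasure P]
      (X : (Fin N → ℝ≥0) → Ω → EuclideanSpace ℝ (Fin d)), IsFractionalBrownianSheet H c X P →
      ∀ s : Fin N → ℝ≥0, (∀ i, (s i : ℝ) ∈ Set.Icc a b) →
      ∀ x : EuclideanSpace ℝ (Fin d), ‖x‖ ≤ M → ∀ ε : ℝ, ε ≤ 1 →
      ENNReal.ofReal (K * ε) ^ d ≤ P {ω | ∀ j, |X s ω j - x j| ≤ ε} := by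
  obtain ⟨v₀, v₁, κ, hv₀, hv₁, hκ, hbd⟩ := exists_sheetCov_bounds hN hH0 hH1 hc ha hab
  -- `M + 1` bounds all points of the intervals, as `‖x‖ ≤ M` and `ε ≤ 1`.
  refine ⟨(√(2 * Real.pi * v₁))⁻¹ * Real.exp (-((M + 1) ^ 2 / (2 * v₀))) * 2, by positivity, ?_⟩
  intro Ω _ P _ X hX s hs x hx ε hε1
  obtain ⟨hb1, hb2, -⟩ := hbd (fun i => s i) hs
  have hprod : P {ω | ∀ j, |X s ω j - x j| ≤ ε} = ∏ j, P {ω | |X s ω j - x j| ≤ ε} :=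
    hX.measure_forall_eq_prod (S := fun j => {f | |f s - x j| ≤ ε}) fun j =>
      measurableSet_le (by fun_prop) measurable_const
  rw [hprod]
  calc _ = ∏ _j : Fin d, ENNReal.ofReal ((√(2 * Real.pi * v₁))⁻¹ *
        Real.exp (-((M + 1) ^ 2 / (2 * v₀))) * (2 * ε)) := by simp [mul_assoc]
    _ ≤ _ := Finset.prod_le_prod' fun j _ =>
      le_measure_abs_sub_le (hX.measurable_coord s j) (hX.hasGaussianLaw_pair s s j).fst
        (hX.centered s j) hv₀ (by rwa [hX.variance_coord]) (by rwa [hX.variance_coord])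
        (add_le_add ((PiLp.norm_apply_le x j).trans hx) hε1)

/-! ### Integrating the two-point bound over time -/

/-- Integration of a power of the norm over an annulus in polar coordinates. -/
lemma lintegral_annulus_rpow_norm {N : ℕ} (hN : 1 ≤ N) {p ρ R : ℝ} (hρ : 0 ≤ ρ) (hρR : ρ ≤ R)
    (hint : IntervalIntegrable (fun r : ℝ => r ^ ((N : ℝ) - p - 1)) volume ρ R) :
    ∫⁻ h : Fin N → ℝ in {h | ρ < ‖h‖ ∧ ‖h‖ ≤ R}, ENNReal.ofReal (‖h‖ ^ (-p)) =
      ENNReal.ofReal (N * volume.real (Metric.ball (0 : Fin N → ℝ) 1) *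
        ∫ r in ρ..R, r ^ ((N : ℝ) - p - 1)) := by
  have : Nonempty (Fin N) := ⟨⟨0, hN⟩⟩
  set f : ℝ → ℝ := (Set.Ioc ρ R).indicator fun r => r ^ (-p) with hf
  have hN1 : ((N - 1 : ℕ) : ℝ) = (N : ℝ) - 1 := by push_cast [hN]; rfl
  have hfun : Set.EqOn (fun r : ℝ => r ^ (Module.finrank ℝ (Fin N → ℝ) - 1) • f r)
      ((Set.Ioc ρ R).indicator fun r => r ^ ((N : ℝ) - p - 1)) (Set.Ioi 0) := by
    intro r hr
    by_cases hm : r ∈ Set.Ioc ρ R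
    · simp only [hf, Set.indicator_of_mem hm, Module.finrank_fin_fun, smul_eq_mul]
      rw [← Real.rpow_natCast, ← Real.rpow_add hr, hN1]; ring_nf
    · simp [hf, Set.indicator_of_notMem hm]
  have hsub : Set.Ioc ρ R ⊆ Set.Ioi 0 := fun r hr => lt_of_le_of_lt hρ hr.1
  have hi1 : IntegrableOn (fun r : ℝ => r ^ (Module.finrank ℝ (Fin N → ℝ) - 1) • f r)
      (Set.Ioi 0) := by
    rw [integrableOn_congr_fun hfun measurableSet_Ioi]
    exact ((integrable_indicator_iff measurableSet_Ioc).2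
      ((intervalIntegrable_iff_integrableOn_Ioc_of_le hρR).1 hint)).integrableOn
  have hi2 : Integrable (fun h : Fin N → ℝ => f ‖h‖) :=
    (integrable_fun_norm_addHaar (volume : Measure (Fin N → ℝ))).2 hi1
  have hf0 : ∀ r, 0 ≤ f r := fun r => Set.indicator_nonneg (fun r hr =>
    Real.rpow_nonneg (hρ.trans hr.1.le) _) r
  have hmeas : MeasurableSet {h : Fin N → ℝ | ρ < ‖h‖ ∧ ‖h‖ ≤ R} :=
    (measurableSet_lt measurable_const measurable_norm).inter
      (measurableSet_le measurable_norm measurable_const)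
  have h1 := integral_fun_norm_addHaar (volume : Measure (Fin N → ℝ)) f
  rw [setIntegral_congr_fun measurableSet_Ioi hfun, setIntegral_indicator measurableSet_Ioc,
    Set.inter_eq_right.2 hsub, ← intervalIntegral.integral_of_le hρR,
    Module.finrank_fin_fun, nsmul_eq_mul, smul_eq_mul, ← mul_assoc] at h1
  rw [← h1, ofReal_integral_eq_lintegral_ofReal hi2 (Filter.Eventually.of_forall fun h => hf0 _),
    ← lintegral_indicator hmeas]
  refine lintegral_congr fun h => ?_
  by_cases hm : ρ < ‖h‖ ∧ ‖h‖ ≤ R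
  · rw [Set.indicator_of_mem (by exact hm), hf, Set.indicator_of_mem (by exact hm)]
  · rw [Set.indicator_of_notMem (by exact hm), hf, Set.indicator_of_notMem (by exact hm)]; simp

lemma ofReal_inv_max_pow_le_left {r z H : ℝ} (hr : 0 < r) (d : ℕ) :
    ENNReal.ofReal (max (r ^ H) z)⁻¹ ^ d ≤ ENNReal.ofReal (r ^ (-(H * d))) := by
  have h0 : 0 < r ^ H := Real.rpow_pos_of_pos hr H
  have h1 : 0 < max (r ^ H) z := lt_max_of_lt_left h0
  rw [← ENNReal.ofReal_pow (by positivity)]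
  apply ENNReal.ofReal_le_ofReal
  rw [Real.rpow_neg hr.le, Real.rpow_mul hr.le, Real.rpow_natCast, ← inv_pow]
  gcongr
  exact le_max_left _ _

/-- The case of a subcritical exponent: the kernel is integrable uniformly in `z`. -/
lemma lintegral_inv_max_le_of_pos {N : ℕ} (hN : 1 ≤ N) (d : ℕ) {H R : ℝ} (hR : 0 < R)
    (hγ : 0 < (N : ℝ) - H * d) (z : ℝ) :
    ∫⁻ h : Fin N → ℝ in Metric.closedBall 0 R, ENNReal.ofReal (max (‖h‖ ^ H) z)⁻¹ ^ d ≤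
      ENNReal.ofReal (N * volume.real (Metric.ball (0 : Fin N → ℝ) 1) *
        (R ^ ((N : ℝ) - H * d) / ((N : ℝ) - H * d))) := by
  have : Nonempty (Fin N) := ⟨⟨0, hN⟩⟩
  have hint : IntervalIntegrable (fun r : ℝ => r ^ ((N : ℝ) - H * d - 1)) volume 0 R :=
    intervalIntegral.intervalIntegrable_rpow' (by linarith)
  have h1 := lintegral_annulus_rpow_norm hN (p := H * d) le_rfl hR.le hint
  rw [integral_rpow (Or.inl (by linarith)), sub_add_cancel, Real.zero_rpow hγ.ne', sub_zero] at h1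
  have hmeas : MeasurableSet {h : Fin N → ℝ | 0 < ‖h‖ ∧ ‖h‖ ≤ R} :=
    (measurableSet_lt measurable_const measurable_norm).inter
      (measurableSet_le measurable_norm measurable_const)
  have hset : (Metric.closedBall (0 : Fin N → ℝ) R : Set (Fin N → ℝ)) =ᵐ[volume]
      {h : Fin N → ℝ | 0 < ‖h‖ ∧ ‖h‖ ≤ R} := by
    filter_upwards [(volume : Measure (Fin N → ℝ)).ae_ne 0] with h hh
    apply propext
    change h ∈ Metric.closedBall (0 : Fin N → ℝ) R ↔ (0 < ‖h‖ ∧ ‖h‖ ≤ R)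
    simp [hh]
  rw [setLIntegral_congr hset, ← h1]
  exact setLIntegral_mono' hmeas fun h hh => ofReal_inv_max_pow_le_left hh.1 d

/-- The contribution of small `h` to the integral is of the critical order. -/
lemma lintegral_inv_max_le_add {N : ℕ} (d : ℕ) {H R z : ℝ} (hz : 0 < z) :
    ∫⁻ h : Fin N → ℝ in Metric.closedBall 0 R, ENNReal.ofReal (max (‖h‖ ^ H) z)⁻¹ ^ d ≤
      ENNReal.ofReal (2 ^ N * z ^ (-((d : ℝ) - N / H))) +
      ∫⁻ h : Fin N → ℝ in {h | z ^ (1 / H) < ‖h‖ ∧ ‖h‖ ≤ R},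
        ENNReal.ofReal (‖h‖ ^ (-(H * d))) := by
  have hρ : 0 < z ^ (1 / H) := Real.rpow_pos_of_pos hz _
  have hmeas : MeasurableSet {h : Fin N → ℝ | z ^ (1 / H) < ‖h‖ ∧ ‖h‖ ≤ R} :=
    (measurableSet_lt measurable_const measurable_norm).inter
      (measurableSet_le measurable_norm measurable_const)
  -- The two terms of the maximum agree at radius `z ^ (1 / H)`. The inner ball has volume `2 ^ N *
  -- z ^ (N / H)`, with integrand at most `z ^ (-d)`.
  have hsub : Metric.closedBall (0 : Fin N → ℝ) R ⊆
      Metric.closedBall 0 (z ^ (1 / H)) ∪ {h | z ^ (1 / H) < ‖h‖ ∧ ‖h‖ ≤ R} := by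
    intro h hh
    rw [mem_closedBall_zero_iff] at hh
    rcases le_or_gt ‖h‖ (z ^ (1 / H)) with h' | h'
    · exact Or.inl (mem_closedBall_zero_iff.2 h')
    · exact Or.inr ⟨h', hh⟩
  refine (lintegral_mono_set hsub).trans ((lintegral_union_le _ _ _).trans (add_le_add ?_ ?_))
  · calc ∫⁻ h : Fin N → ℝ in Metric.closedBall 0 (z ^ (1 / H)),
          ENNReal.ofReal (max (‖h‖ ^ H) z)⁻¹ ^ d
        ≤ ∫⁻ _ : Fin N → ℝ in Metric.closedBall 0 (z ^ (1 / H)), ENNReal.ofReal z⁻¹ ^ d := by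
          refine lintegral_mono fun h => ?_
          gcongr
          exact le_max_right _ _
      _ = ENNReal.ofReal (2 ^ N * z ^ (-((d : ℝ) - N / H))) := by
          rw [setLIntegral_const, Real.volume_pi_closedBall _ hρ.le, Fintype.card_fin,
            ← ENNReal.ofReal_pow (by positivity), ← ENNReal.ofReal_mul (by positivity)]
          congr 1
          rw [mul_pow, ← Real.rpow_natCast (z ^ (1 / H)), ← Real.rpow_mul hz.le, ← Real.rpow_neg_one,
            ← Real.rpow_natCast (z ^ (-1 : ℝ)), ← Real.rpow_mul hz.le, mul_left_comm,
            ← Real.rpow_add hz]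
          congr 2
          ring
  · exact setLIntegral_mono' hmeas fun h hh => ofReal_inv_max_pow_le_left (hρ.trans hh.1) d

/-- Since `N - H d < 0`, the annulus integral is dominated by its inner endpoint `z ^ (1 / H)`, so
it has the same order as the inner ball and the bound does not depend on `R`. -/
lemma lintegral_inv_max_le_of_neg {N : ℕ} (hN : 1 ≤ N) (d : ℕ) {H R z : ℝ} (hH : 0 < H)
    (hγ : 0 < (d : ℝ) - N / H) (hz : 0 < z) :
    ∫⁻ h : Fin N → ℝ in Metric.closedBall 0 R, ENNReal.ofReal (max (‖h‖ ^ H) z)⁻¹ ^ d ≤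
      ENNReal.ofReal ((2 ^ N + N * volume.real (Metric.ball (0 : Fin N → ℝ) 1) /
        (H * ((d : ℝ) - N / H))) * z ^ (-((d : ℝ) - N / H))) := by
  have hρ : 0 < z ^ (1 / H) := Real.rpow_pos_of_pos hz _
  refine (lintegral_inv_max_le_add d hz).trans ?_
  rw [add_mul, ENNReal.ofReal_add (by positivity) (by positivity)]
  gcongr
  rcases le_or_gt (z ^ (1 / H)) R with hR | hR
  · have h0 : (0 : ℝ) ∉ Set.uIcc (z ^ (1 / H)) R := by
      rw [Set.uIcc_of_le hR]; exact fun h => absurd h.1 (not_le.2 hρ)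
    have hγ' : (N : ℝ) - H * d = -(H * ((d : ℝ) - N / H)) := by field_simp; ring
    have hHγ : 0 < H * ((d : ℝ) - N / H) := by positivity
    have hint : IntervalIntegrable (fun r : ℝ => r ^ ((N : ℝ) - H * d - 1)) volume
        (z ^ (1 / H)) R := intervalIntegral.intervalIntegrable_rpow (Or.inr h0)
    rw [lintegral_annulus_rpow_norm hN hρ.le hR hint,
      integral_rpow (Or.inr ⟨by rw [hγ']; linarith, h0⟩), sub_add_cancel, hγ', ← Real.rpow_mul hz.le]
    apply ENNReal.ofReal_le_ofReal
    have he : 1 / H * -(H * ((d : ℝ) - N / H)) = -((d : ℝ) - N / H) := by field_simp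
    rw [he, div_neg, ← neg_div, neg_sub]
    have hRp : 0 ≤ R ^ (-(H * ((d : ℝ) - N / H))) := Real.rpow_nonneg (hρ.le.trans hR) _
    calc _ ≤ N * volume.real (Metric.ball (0 : Fin N → ℝ) 1) *
          (z ^ (-((d : ℝ) - N / H)) / (H * ((d : ℝ) - N / H))) := by
          gcongr
          linarith
      _ = _ := by ring
  · have : {h : Fin N → ℝ | z ^ (1 / H) < ‖h‖ ∧ ‖h‖ ≤ R} = ∅ := by
      ext h
      simp only [Set.mem_ofPred_eq, Set.mem_empty_iff_false, iff_false, not_and, not_le]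
      intro h'; linarith
    rw [this]; simp

/-- At the critical exponent the radial integral is `log R - (1 / H) log z`. Additive constants are
absorbed because `z < 2 M` gives `log (3 M / z) ≥ log (3 / 2) > 0`. -/
lemma exists_lintegral_inv_max_le_log {N : ℕ} (hN : 1 ≤ N) (d : ℕ) {H R M : ℝ} (hH : 0 < H)
    (hR : 0 < R) (hM : 0 < M) (hγ : (d : ℝ) - N / H = 0) :
    ∃ C : ℝ, 0 < C ∧ ∀ z, 0 < z → z < 2 * M →
    ∫⁻ h : Fin N → ℝ in Metric.closedBall 0 R, ENNReal.ofReal (max (‖h‖ ^ H) z)⁻¹ ^ d ≤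
      ENNReal.ofReal (C * Real.log (3 * M / z)) := by
  set V := volume.real (Metric.ball (0 : Fin N → ℝ) 1)
  set l := Real.log (3 / 2)
  have hl : 0 < l := Real.log_pos (by norm_num)
  have hV : 0 ≤ V := measureReal_nonneg
  set B := |Real.log R| + 1 / H * |Real.log (3 * M)|
  have hB : 0 ≤ B := by positivity
  refine ⟨2 ^ N / l + N * V * (B / l + 1 / H), by positivity, fun z hz hzM => ?_⟩
  have hlz : l ≤ Real.log (3 * M / z) := by
    apply Real.log_le_log (by norm_num)
    rw [le_div_iff₀ hz]; linarith
  set lz := Real.log (3 * M / z) with hlzdef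
  have hlz0 : 0 < lz := hl.trans_le hlz
  have hlz1 : 1 ≤ lz / l := (one_le_div hl).2 hlz
  have hρ : 0 < z ^ (1 / H) := Real.rpow_pos_of_pos hz _
  refine (lintegral_inv_max_le_add d hz).trans ?_
  rw [add_mul, ENNReal.ofReal_add (by positivity) (by positivity)]
  apply add_le_add
  · apply ENNReal.ofReal_le_ofReal
    rw [hγ, neg_zero, Real.rpow_zero, div_mul_eq_mul_div, mul_div_assoc]
    gcongr
  rcases le_or_gt (z ^ (1 / H)) R with h' | h'
  · have h0 : (0 : ℝ) ∉ Set.uIcc (z ^ (1 / H)) R := by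
      rw [Set.uIcc_of_le h']; exact fun h => absurd h.1 (not_le.2 hρ)
    have hγ' : (N : ℝ) - H * d - 1 = -1 := by
      have : (d : ℝ) = N / H := by linarith
      rw [this]; field_simp; ring
    have hint : IntervalIntegrable (fun r : ℝ => r ^ ((N : ℝ) - H * d - 1)) volume
        (z ^ (1 / H)) R := intervalIntegral.intervalIntegrable_rpow (Or.inr h0)
    rw [lintegral_annulus_rpow_norm hN hρ.le h' hint, hγ']
    simp_rw [Real.rpow_neg_one]
    rw [integral_inv h0, Real.log_div hR.ne' hρ.ne', Real.log_rpow hz]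
    apply ENNReal.ofReal_le_ofReal
    rw [mul_assoc (_ * _)]
    refine mul_le_mul_of_nonneg_left ?_ (by positivity)
    have e1 : Real.log z = Real.log (3 * M) - lz := by
      rw [hlzdef, Real.log_div (by positivity) hz.ne']; ring
    have e2 : B ≤ B / l * lz := by
      rw [div_mul_eq_mul_div, mul_div_assoc]; exact le_mul_of_one_le_right hB hlz1
    have e3 : Real.log R - 1 / H * Real.log z ≤ B + 1 / H * lz := by
      rw [e1]
      have a1 := le_abs_self (Real.log R)
      have a2 : -(1 / H * Real.log (3 * M)) ≤ 1 / H * |Real.log (3 * M)| := by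
        rw [← mul_neg]
        exact mul_le_mul_of_nonneg_left (neg_le_abs _) (by positivity)
      simp only [B]
      linarith
    linarith
  · have : {h : Fin N → ℝ | z ^ (1 / H) < ‖h‖ ∧ ‖h‖ ≤ R} = ∅ := by
      ext h
      simp only [Set.mem_ofPred_eq, Set.mem_empty_iff_false, iff_false, not_and, not_le]
      intro h'; linarith
    rw [this]; simp

/-- The kernel whose energy controls the second moment of the occupation measure: the Newtonian
kernel, or the constant `1` for negative exponents. -/
noncomputable def hittingKernel {d : ℕ} (M β : ℝ) (w : EuclideanSpace ℝ (Fin d)) : ℝ≥0∞ :=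
  if β < 0 then 1 else newtonKernel M β w

lemma exists_lintegral_inv_max_le {N : ℕ} (hN : 1 ≤ N) (d : ℕ) {H R M : ℝ} (hH : 0 < H)
    (hR : 0 < R) (hM : 0 < M) :
    ∃ C : ℝ, 0 < C ∧ ∀ w : EuclideanSpace ℝ (Fin d), ‖w‖ < 2 * M →
    ∫⁻ h : Fin N → ℝ in Metric.closedBall 0 R, ENNReal.ofReal (max (‖h‖ ^ H) ‖w‖)⁻¹ ^ d ≤
      ENNReal.ofReal C * hittingKernel M ((d : ℝ) - N / H) w := by
  have hV : 0 ≤ volume.real (Metric.ball (0 : Fin N → ℝ) 1) := measureReal_nonneg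
  rcases lt_trichotomy ((d : ℝ) - N / H) 0 with hβ | hβ | hβ
  · have hγ : 0 < (N : ℝ) - H * d := by
      have : (d : ℝ) < N / H := by linarith
      rw [lt_div_iff₀ hH] at this; linarith
    refine ⟨N * volume.real (Metric.ball (0 : Fin N → ℝ) 1) *
        (R ^ ((N : ℝ) - H * d) / ((N : ℝ) - H * d)) + 1, by positivity, fun w _ => ?_⟩
    rw [hittingKernel, if_pos hβ, mul_one]
    exact (lintegral_inv_max_le_of_pos hN d hR hγ ‖w‖).trans
      (ENNReal.ofReal_le_ofReal (by linarith))
  · obtain ⟨C, hC, hbd⟩ := exists_lintegral_inv_max_le_log hN d hH hR hM hβ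
    refine ⟨C, hC, fun w hw => ?_⟩
    rw [hittingKernel, if_neg hβ.not_lt, newtonKernel]
    by_cases hw0 : w = 0
    · rw [if_pos hw0, ENNReal.mul_top (by simpa using hC)]; exact le_top
    · rw [if_neg hw0, if_pos hβ, ← ENNReal.ofReal_mul hC.le]
      exact hbd _ (norm_pos_iff.2 hw0) hw
  · have hC : 0 < 2 ^ N + N * volume.real (Metric.ball (0 : Fin N → ℝ) 1) /
        (H * ((d : ℝ) - N / H)) := by positivity
    refine ⟨_, hC, fun w hw => ?_⟩
    rw [hittingKernel, if_neg hβ.le.not_gt, newtonKernel]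
    by_cases hw0 : w = 0
    · rw [if_pos hw0, ENNReal.mul_top (by simpa using hC)]; exact le_top
    · rw [if_neg hw0, if_neg hβ.ne', ← ENNReal.ofReal_mul hC.le]
      exact lintegral_inv_max_le_of_neg hN d hH hβ (norm_pos_iff.2 hw0)

/-! ### Second moment method and preparation of the paths -/

/-- Cauchy-Schwarz applied to `J` and the indicator of `J ≠ 0`. -/
lemma sq_lintegral_le_lintegral_sq_mul {Ω : Type*} [MeasurableSpace Ω] {P : Measure Ω}
    {J : Ω → ℝ≥0∞} (hJ : Measurable J) :
    (∫⁻ ω, J ω ∂P) ^ 2 ≤ (∫⁻ ω, J ω ^ 2 ∂P) * P {ω | J ω ≠ 0} := by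
  have hE : MeasurableSet {ω | J ω ≠ 0} := (hJ (measurableSet_singleton 0)).compl
  set g : Ω → ℝ≥0∞ := {ω | J ω ≠ 0}.indicator 1
  have hg : Measurable g := measurable_one.indicator hE
  have h := ENNReal.lintegral_mul_le_Lp_mul_Lq P Real.HolderConjugate.two_two hJ.aemeasurable
    hg.aemeasurable
  have h1 : J * g = J := by
    ext ω
    by_cases hω : J ω = 0 <;> simp [g, hω]
  have h2 : ∫⁻ ω, g ω ^ (2 : ℝ) ∂P = P {ω | J ω ≠ 0} := by
    rw [← lintegral_indicator_one hE]
    refine lintegral_congr fun ω => ?_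
    by_cases hω : J ω = 0 <;> simp [g, hω]
  rw [h1, h2] at h
  calc (∫⁻ ω, J ω ∂P) ^ 2 ≤ _ := pow_le_pow_left' h 2
    _ = _ := by
      rw [mul_pow, ← ENNReal.rpow_natCast, ← ENNReal.rpow_mul, ← ENNReal.rpow_natCast (P _ ^ _),
        ← ENNReal.rpow_mul]
      simp

/-- The second moment method for the measure of the sections of a measurable set. -/
lemma exists_sq_lintegral_measure_le {S Ω : Type*} [MeasurableSpace S] [MeasurableSpace Ω]
    (l : Measure S) [SFinite l] (P : Measure Ω) [SFinite P] {D : Set (S × Ω)}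
    (hD : MeasurableSet D) {G : Set S} (hG : l Gᶜ = 0) :
    ∃ B : Set Ω, MeasurableSet B ∧ (∀ ω ∈ B, ∃ p ∈ G, (p, ω) ∈ D) ∧
      (∫⁻ p, P {ω | (p, ω) ∈ D} ∂l) ^ 2 ≤
        (∫⁻ p, ∫⁻ q, P {ω | (p, ω) ∈ D ∧ (q, ω) ∈ D} ∂l ∂l) * P B := by
  set J : Ω → ℝ≥0∞ := fun ω => l {p | (p, ω) ∈ D}
  have hJ : Measurable J := measurable_measure_prodMk_right hD
  refine ⟨{ω | J ω ≠ 0}, (hJ (measurableSet_singleton 0)).compl, fun ω hω => ?_, ?_⟩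
  · by_contra! hc
    exact hω (measure_mono_null (t := Gᶜ) (fun p hp hpG => hc p hpG hp) hG)
  have h1 : ∫⁻ p, P {ω | (p, ω) ∈ D} ∂l = ∫⁻ ω, J ω ∂P :=
    (Measure.prod_apply hD).symm.trans (Measure.prod_apply_symm hD)
  set D₂ : Set ((S × S) × Ω) := {z | (z.1.1, z.2) ∈ D ∧ (z.1.2, z.2) ∈ D}
  have hD₂ : MeasurableSet D₂ :=
    (hD.preimage (f := fun z : (S × S) × Ω => (z.1.1, z.2)) (by fun_prop)).inter
      (hD.preimage (f := fun z : (S × S) × Ω => (z.1.2, z.2)) (by fun_prop))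
  have h2 : ∫⁻ p, ∫⁻ q, P {ω | (p, ω) ∈ D ∧ (q, ω) ∈ D} ∂l ∂l = ∫⁻ ω, J ω ^ 2 ∂P := by
    calc _ = ∫⁻ z, P (Prod.mk z ⁻¹' D₂) ∂(l.prod l) :=
          (lintegral_prod (fun z : S × S => P (Prod.mk z ⁻¹' D₂))
            (measurable_measure_prodMk_left hD₂).aemeasurable).symm
      _ = ∫⁻ ω, (l.prod l) ((fun z => (z, ω)) ⁻¹' D₂) ∂P :=
          (Measure.prod_apply hD₂).symm.trans (Measure.prod_apply_symm hD₂)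
      _ = _ := lintegral_congr fun ω => by
          rw [sq, ← Measure.prod_prod]; rfl
  rw [h1, h2]
  exact sq_lintegral_le_lintegral_sq_mul hJ

/-- The distance from `f t` to `A` attains its minimum on the compact `S`; the approximate hits
force this minimum to be `0`, and `A` is closed. -/
lemma exists_mem_of_frequently_near {T : Type*} [TopologicalSpace T] {d : ℕ} (hd : 1 ≤ d)
    {f : T → EuclideanSpace ℝ (Fin d)} (hf : Continuous f) {S : Set T} (hS : IsCompact S)
    {A : Set (EuclideanSpace ℝ (Fin d))} (hA : IsCompact A)
    (h : ∀ δ : ℝ, 0 < δ → ∃ t ∈ S, ∃ x ∈ A, ∀ j, |f t j - x j| ≤ δ) : ∃ t ∈ S, f t ∈ A := by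
  have hd0 : (0 : ℝ) < d := by exact_mod_cast hd
  obtain ⟨t₁, ht₁, x₁, hx₁, -⟩ := h 1 one_pos
  obtain ⟨t₀, ht₀, hmin⟩ := hS.exists_isMinOn ⟨t₁, ht₁⟩
    ((Metric.continuous_infDist_pt A).comp hf).continuousOn
  refine ⟨t₀, ht₀, ?_⟩
  by_contra hmem
  have hpos : 0 < Metric.infDist (f t₀) A :=
    (hA.isClosed.notMem_iff_infDist_pos ⟨x₁, hx₁⟩).1 hmem
  obtain ⟨t, ht, x, hx, hj⟩ := h (Metric.infDist (f t₀) A / (2 * d)) (by positivity)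
  obtain ⟨j, hnorm⟩ := EuclideanSpace.exists_norm_le_mul_abs hd (f t - x)
  have h1 : Metric.infDist (f t₀) A ≤ Metric.infDist (f t) A := hmin ht
  have h2 : Metric.infDist (f t) A ≤ ‖f t - x‖ := by
    rw [← dist_eq_norm]; exact Metric.infDist_le_dist_of_mem hx
  have h3 : d * |(f t - x) j| ≤ Metric.infDist (f t₀) A / 2 := by
    calc d * |(f t - x) j| ≤ d * (Metric.infDist (f t₀) A / (2 * d)) :=
          mul_le_mul_of_nonneg_left (hj j) hd0.le
      _ = _ := by field_simp
  linarith

/-- Continuity of every path yields joint measurability in `(t, ω)`, which Tonelli requires. Real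
time parameters give access to Lebesgue measure. -/
lemma IsFractionalBrownianSheet.exists_continuous_modification {N d : ℕ} {Ω : Type*}
    [MeasurableSpace Ω] {H c : ℝ} {P : Measure Ω}
    {X : (Fin N → ℝ≥0) → Ω → EuclideanSpace ℝ (Fin d)} (hX : IsFractionalBrownianSheet H c X P) :
    ∃ Y : (Fin N → ℝ) → Ω → EuclideanSpace ℝ (Fin d), (∀ ω, Continuous fun t => Y t ω) ∧
      (∀ t, Measurable (Y t)) ∧ ∀ᵐ ω ∂P, ∀ t, Y t ω = X (fun i => (t i).toNNReal) ω := by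
  -- The set of continuous paths need not be measurable, so a measurable subset of full measure is
  -- used.
  set G : Set Ω := (toMeasurable P {ω | Continuous fun t => X t ω}ᶜ)ᶜ
  have hG : MeasurableSet G := (measurableSet_toMeasurable _ _).compl
  have hGc : ∀ ω ∈ G, Continuous fun t => X t ω := fun ω hω => by
    by_contra h; exact hω (subset_toMeasurable _ _ h)
  have hP : P Gᶜ = 0 := by
    rw [compl_compl, measure_toMeasurable]; exact hX.continuous_paths
  refine ⟨fun t => G.indicator (X fun i => (t i).toNNReal), fun ω => ?_,
    fun t => (hX.measurable _).indicator hG, ?_⟩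
  · by_cases hω : ω ∈ G
    · simp only [Set.indicator_of_mem hω]
      exact (hGc ω hω).comp (by fun_prop)
    · simp only [Set.indicator_of_notMem hω]
      exact continuous_const
  · filter_upwards [compl_mem_ae_iff.2 hP] with ω hω t
    rw [compl_compl] at hω
    exact Set.indicator_of_mem hω _

/-! ### The hitting bound and the theorem -/

lemma measurable_hittingKernel {d : ℕ} (M β : ℝ) :
    Measurable (hittingKernel M β : EuclideanSpace ℝ (Fin d) → ℝ≥0∞) := by
  classical
  unfold hittingKernel
  split_ifs
  · exact measurable_const
  · unfold newtonKernel
    refine Measurable.ite (measurableSet_singleton 0) measurable_const ?_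
    split_ifs
    · exact (Real.measurable_log.comp (measurable_const.div measurable_norm)).ennreal_ofReal
    · exact (measurable_norm.pow_const _).ennreal_ofReal

/-- Translation by `s` sends the cube into the sup-norm ball of radius `b - a`, and points of `A`
differ by less than `2 M`, so the time integral is controlled by the kernel. -/
lemma lintegral_lintegral_inv_max_le {N d : ℕ} {H a b : ℝ}
    {M C : ℝ} {ν : Measure (Fin N → ℝ)} {μ : Measure (EuclideanSpace ℝ (Fin d))}
    (hν : ν = volume.restrict (Set.Icc (fun _ => a) (fun _ => b)))
    {A : Set (EuclideanSpace ℝ (Fin d))} (hAM : A ⊆ Metric.ball 0 M) (hμA : μ Aᶜ = 0)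
    (hC : ∀ w : EuclideanSpace ℝ (Fin d), ‖w‖ < 2 * M →
      ∫⁻ h : Fin N → ℝ in Metric.closedBall 0 (b - a), ENNReal.ofReal (max (‖h‖ ^ H) ‖w‖)⁻¹ ^ d ≤
        ENNReal.ofReal C * hittingKernel M ((d : ℝ) - N / H) w)
    (hab : a ≤ b) {x : EuclideanSpace ℝ (Fin d)} (hx : x ∈ A) {s : Fin N → ℝ}
    (hs : s ∈ Set.Icc (fun _ => a) (fun _ => b)) :
    ∫⁻ y, ∫⁻ t, ENNReal.ofReal (max (‖t - s‖ ^ H) ‖x - y‖)⁻¹ ^ d ∂ν ∂μ ≤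
      ENNReal.ofReal C * ∫⁻ y, hittingKernel M ((d : ℝ) - N / H) (x - y) ∂μ := by
  have hm : Measurable fun y => hittingKernel M ((d : ℝ) - N / H) (x - y) :=
    (measurable_hittingKernel M _).comp (measurable_const.sub measurable_id)
  rw [← lintegral_const_mul _ hm]
  refine lintegral_mono_ae ?_
  filter_upwards [compl_mem_ae_iff.2 hμA] with y hy
  rw [compl_compl] at hy
  have hxM : ‖x‖ < M := mem_ball_zero_iff.1 (hAM hx)
  have hyM : ‖y‖ < M := mem_ball_zero_iff.1 (hAM hy)
  refine le_trans ?_ (hC (x - y) (by linarith [norm_sub_le x y]))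
  set f : (Fin N → ℝ) → ℝ≥0∞ := fun h => ENNReal.ofReal (max (‖h‖ ^ H) ‖x - y‖)⁻¹ ^ d
  rw [← lintegral_indicator Metric.isClosed_closedBall.measurableSet,
    ← lintegral_sub_right_eq_self (μ := volume) ((Metric.closedBall 0 (b - a)).indicator f) s, hν]
  refine (setLIntegral_mono' measurableSet_Icc fun t ht => ?_).trans (setLIntegral_le_lintegral _ _)
  rw [Set.indicator_of_mem]
  rw [mem_closedBall_zero_iff, pi_norm_le_iff_of_nonneg (by linarith)]
  intro i
  rw [Real.norm_eq_abs, abs_le, Pi.sub_apply]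
  constructor <;> linarith [ht.1 i, ht.2 i, hs.1 i, hs.2 i]

/-- Lower bound for the hitting probability in terms of the energy of a probability measure on the
target. -/
lemma exists_hitting_bound {N d : ℕ} (hN : 1 ≤ N) (hd : 1 ≤ d) {H c a b M : ℝ}
    (hH0 : 0 < H) (hH1 : H < 1) (hc : 0 < c) (ha : 0 < a) (hab : a < b) (hM : 0 < M) :
    ∃ K : ℝ, 0 < K ∧ ∀ (Ω : Type*) [MeasurableSpace Ω] (P : Measure Ω) [IsProbabilityMeasure P]
      (X : (Fin N → ℝ≥0) → Ω → EuclideanSpace ℝ (Fin d)), IsFractionalBrownianSheet H c X P →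
      ∀ A : Set (EuclideanSpace ℝ (Fin d)), IsCompact A → A ⊆ Metric.ball 0 M →
      ∀ μ : Measure (EuclideanSpace ℝ (Fin d)), IsProbabilityMeasure μ → μ Aᶜ = 0 →
      ENNReal.ofReal K * (kernelEnergy (hittingKernel M ((d : ℝ) - N / H)) μ)⁻¹ ≤
        P {ω | ∃ t : Fin N → ℝ≥0, (∀ i, a ≤ (t i : ℝ) ∧ (t i : ℝ) ≤ b) ∧ X t ω ∈ A} := by
  obtain ⟨K₁, hK₁, h2pt⟩ := exists_measure_two_point_le (d := d) hN hd hH0 hH1 hc ha hab hM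
  obtain ⟨K₀, hK₀, h1pt⟩ := exists_le_measure_one_point (d := d) (M := M) hN hH0 hH1 hc ha hab
  obtain ⟨C, hC, hint⟩ := exists_lintegral_inv_max_le hN d hH0 (sub_pos.2 hab) hM
  have hba : 0 < b - a := sub_pos.2 hab
  -- The square of the first moment bound divided by the second moment bound without its energy
  -- factor; `ε ^ (2 d)` cancels.
  refine ⟨(K₀ ^ d) ^ 2 * (b - a) ^ N / (K₁ ^ d * C), by positivity, ?_⟩
  intro Ω _ P _ X hX A hA hAM μ _ hμA
  obtain ⟨Y, hYc, hYm, hYX⟩ := hX.exists_continuous_modification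
  set En := kernelEnergy (hittingKernel M ((d : ℝ) - N / H)) μ with hEn
  set Q : Set (Fin N → ℝ) := Set.Icc (fun _ => a) (fun _ => b)
  set ν : Measure (Fin N → ℝ) := volume.restrict Q with hν
  have hνuniv : ν Set.univ = ENNReal.ofReal ((b - a) ^ N) := by
    rw [hν, Measure.restrict_apply_univ, Real.volume_Icc_pi, ENNReal.ofReal_pow hba.le]; simp
  have hνfin : IsFiniteMeasure ν := ⟨by rw [hνuniv]; exact ENNReal.ofReal_lt_top⟩
  have hcoe : ∀ t ∈ Q, (fun i => ((t i).toNNReal : ℝ)) = t := fun t ht => by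
    ext i; exact Real.coe_toNNReal _ (ha.le.trans (ht.1 i))
  have hcoeI : ∀ t ∈ Q, ∀ i, ((t i).toNNReal : ℝ) ∈ Set.Icc a b := fun t ht i => by
    rw [congrFun (hcoe t ht) i]; exact ⟨ht.1 i, ht.2 i⟩
  set G : Set (EuclideanSpace ℝ (Fin d) × (Fin N → ℝ)) := A ×ˢ Q
  have hG : (μ.prod ν) Gᶜ = 0 := by
    have hQ : ν Qᶜ = 0 := by
      rw [hν, Measure.restrict_apply measurableSet_Icc.compl, Set.compl_inter_self, measure_empty]
    rw [Set.compl_prod_eq_union]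
    refine measure_union_null ?_ ?_ <;> rw [Measure.prod_prod] <;> simp [hμA, hQ]
  have hGae : ∀ᵐ p ∂(μ.prod ν), p ∈ G := by
    filter_upwards [compl_mem_ae_iff.2 hG] with p hp using by rwa [compl_compl] at hp
  have hYmeas : Measurable (Function.uncurry Y) :=
    measurable_uncurry_of_continuous_of_measurable hYc hYm
  have key : ∀ ε : ℝ, 0 < ε → ε ≤ 1 → ∃ B : Set Ω, MeasurableSet B ∧
      (∀ ω ∈ B, ∃ t ∈ Q, ∃ x ∈ A, ∀ j, |Y t ω j - x j| ≤ ε) ∧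
      ENNReal.ofReal ((K₀ ^ d) ^ 2 * (b - a) ^ N / (K₁ ^ d * C)) * En⁻¹ ≤ P B := by
    intro ε hε hε1
    set D : Set ((EuclideanSpace ℝ (Fin d) × (Fin N → ℝ)) × Ω) :=
      {z | ∀ j, |Y z.1.2 z.2 j - z.1.1 j| ≤ ε} with hDdef
    have hD : MeasurableSet D := by
      have : D = ⋂ j, {z | |Y z.1.2 z.2 j - z.1.1 j| ≤ ε} := by
        ext z; simp [hDdef]
      rw [this]
      refine MeasurableSet.iInter fun j => measurableSet_le ?_ measurable_const
      have h1 : Measurable fun z : (EuclideanSpace ℝ (Fin d) × (Fin N → ℝ)) × Ω =>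
          Y z.1.2 z.2 := hYmeas.comp (by fun_prop : Measurable fun
            z : (EuclideanSpace ℝ (Fin d) × (Fin N → ℝ)) × Ω => (z.1.2, z.2))
      have h2 : Measurable fun v : EuclideanSpace ℝ (Fin d) => v j :=
        (EuclideanSpace.proj (𝕜 := ℝ) j).continuous.measurable
      exact ((h2.comp h1).sub (h2.comp (measurable_fst.comp measurable_fst))).abs
    obtain ⟨B, hB, hBsub, hBle⟩ := exists_sq_lintegral_measure_le (μ.prod ν) P hD hG
    refine ⟨B, hB, fun ω hω => ?_, ?_⟩
    · obtain ⟨⟨x, t⟩, ⟨hx, ht⟩, hp⟩ := hBsub ω hω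
      exact ⟨t, ht, x, hx, hp⟩
    have hfirst : ENNReal.ofReal (K₀ * ε) ^ d * ENNReal.ofReal ((b - a) ^ N) ≤
        ∫⁻ p, P {ω | (p, ω) ∈ D} ∂(μ.prod ν) := by
      calc _ = ∫⁻ _p, ENNReal.ofReal (K₀ * ε) ^ d ∂(μ.prod ν) := by
            rw [lintegral_const, ← Set.univ_prod_univ, Measure.prod_prod, hνuniv, measure_univ,
              one_mul]
        _ ≤ _ := by
            refine lintegral_mono_ae (hGae.mono ?_)
            rintro ⟨x, t⟩ ⟨hx, ht⟩
            refine (h1pt Ω P X hX _ (hcoeI t ht) x (mem_ball_zero_iff.1 (hAM hx)).le ε hε1).trans_eq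
              (measure_congr ?_)
            filter_upwards [hYX] with ω hω
            apply propext
            change (∀ j, _) ↔ (∀ j, |Y t ω j - x j| ≤ ε)
            rw [hω t]
    have hsecond : ∫⁻ p, ∫⁻ q, P {ω | (p, ω) ∈ D ∧ (q, ω) ∈ D} ∂(μ.prod ν) ∂(μ.prod ν) ≤
        ENNReal.ofReal (K₁ * ε ^ 2) ^ d * ENNReal.ofReal C * ENNReal.ofReal ((b - a) ^ N) * En := by
      have hker : Measurable fun z : EuclideanSpace ℝ (Fin d) × EuclideanSpace ℝ (Fin d) =>
        hittingKernel M ((d : ℝ) - N / H) (z.1 - z.2) :=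
        (measurable_hittingKernel M _).comp (measurable_fst.sub measurable_snd)
      have hinner : ∀ p ∈ G, ∫⁻ q, P {ω | (p, ω) ∈ D ∧ (q, ω) ∈ D} ∂(μ.prod ν) ≤
          ENNReal.ofReal (K₁ * ε ^ 2) ^ d * ENNReal.ofReal C *
            ∫⁻ y, hittingKernel M ((d : ℝ) - N / H) (p.1 - y) ∂μ := by
        rintro ⟨x, s⟩ ⟨hx, hs⟩
        have hsec : MeasurableSet {z : (EuclideanSpace ℝ (Fin d) × (Fin N → ℝ)) × Ω |
            (((x, s), z.2) : (EuclideanSpace ℝ (Fin d) × (Fin N → ℝ)) × Ω) ∈ D ∧ z ∈ D} :=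
          (hD.preimage (by fun_prop)).inter hD
        rw [lintegral_prod (fun q => P {ω | ((x, s), ω) ∈ D ∧ (q, ω) ∈ D})
          (measurable_measure_prodMk_left hsec).aemeasurable]
        calc _ ≤ ∫⁻ y, ∫⁻ t, ENNReal.ofReal (K₁ * ε ^ 2) ^ d *
              ENNReal.ofReal (max (‖t - s‖ ^ H) ‖x - y‖)⁻¹ ^ d ∂ν ∂μ := by
              refine lintegral_mono fun y => lintegral_mono_ae ?_
              have h1 : ∀ᵐ t ∂ν, t ∈ Q := ae_restrict_mem measurableSet_Icc
              -- The two-point estimate excludes the diagonal, which is null in time.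
              have h2 : ∀ᵐ t ∂ν, t ≠ s := by
                have : Nonempty (Fin N) := ⟨⟨0, hN⟩⟩
                exact ae_restrict_of_ae ((volume : Measure (Fin N → ℝ)).ae_ne s)
              filter_upwards [h1, h2] with t ht hts
              have hne : (fun i => (s i).toNNReal) ≠ fun i => (t i).toNNReal := fun h => hts <| by
                rw [← hcoe t ht, ← hcoe s hs]
                ext i; rw [congrFun h i]
              have := h2pt Ω P X hX _ _ (hcoeI s hs) (hcoeI t ht) hne x y
                (mem_ball_zero_iff.1 (hAM hx)).le ε hε
              rw [hcoe t ht, hcoe s hs] at this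
              rw [← mul_pow, ← ENNReal.ofReal_mul (by positivity), mul_assoc, ← div_eq_mul_inv]
              refine le_trans (le_of_eq (measure_congr ?_)) this
              filter_upwards [hYX] with ω hω
              apply propext
              change ((∀ j, |Y s ω j - x j| ≤ ε) ∧ ∀ j, |Y t ω j - y j| ≤ ε) ↔ (_ ∧ _)
              rw [hω t, hω s]
          _ = ENNReal.ofReal (K₁ * ε ^ 2) ^ d * ∫⁻ y, ∫⁻ t,
              ENNReal.ofReal (max (‖t - s‖ ^ H) ‖x - y‖)⁻¹ ^ d ∂ν ∂μ := by
              have hfin : ENNReal.ofReal (K₁ * ε ^ 2) ^ d ≠ ⊤ :=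
                ENNReal.pow_ne_top ENNReal.ofReal_ne_top
              simp_rw [lintegral_const_mul' _ _ hfin]
          _ ≤ _ := by
              rw [mul_assoc]
              exact mul_le_mul_right (lintegral_lintegral_inv_max_le hν hAM hμA hint
                hab.le hx hs) _
      calc _ ≤ ∫⁻ p, ENNReal.ofReal (K₁ * ε ^ 2) ^ d * ENNReal.ofReal C *
            ∫⁻ y, hittingKernel M ((d : ℝ) - N / H) (p.1 - y) ∂μ ∂(μ.prod ν) :=
            lintegral_mono_ae (hGae.mono hinner)
        _ = ENNReal.ofReal (K₁ * ε ^ 2) ^ d * ENNReal.ofReal C * (∫⁻ p,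
            ∫⁻ y, hittingKernel M ((d : ℝ) - N / H) (p.1 - y) ∂μ ∂(μ.prod ν)) :=
            lintegral_const_mul' _ _ (ENNReal.mul_ne_top
              (ENNReal.pow_ne_top ENNReal.ofReal_ne_top) ENNReal.ofReal_ne_top)
        _ = _ := by
            rw [lintegral_prod (fun p : EuclideanSpace ℝ (Fin d) × (Fin N → ℝ) =>
              ∫⁻ y, hittingKernel M ((d : ℝ) - N / H) (p.1 - y) ∂μ)
              (hker.lintegral_prod_right'.comp measurable_fst).aemeasurable]
            simp only [lintegral_const, hνuniv]
            rw [lintegral_mul_const' _ _ ENNReal.ofReal_ne_top, hEn, kernelEnergy]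
            ring
    have hmain : (ENNReal.ofReal (K₀ * ε) ^ d * ENNReal.ofReal ((b - a) ^ N)) ^ 2 ≤
        ENNReal.ofReal (K₁ * ε ^ 2) ^ d * ENNReal.ofReal C * ENNReal.ofReal ((b - a) ^ N) * En *
          P B := (pow_le_pow_left' hfirst 2).trans (hBle.trans (mul_le_mul_left hsecond _))
    set W := ENNReal.ofReal (K₁ * ε ^ 2) ^ d * ENNReal.ofReal C * ENNReal.ofReal ((b - a) ^ N)
      with hW
    have hW' : W = ENNReal.ofReal ((K₁ * ε ^ 2) ^ d * C * (b - a) ^ N) := by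
      rw [hW, ← ENNReal.ofReal_pow (by positivity), ← ENNReal.ofReal_mul (by positivity),
        ← ENNReal.ofReal_mul (by positivity)]
    have hW0 : W ≠ 0 := by
      rw [hW']; exact (ENNReal.ofReal_pos.2 (by positivity)).ne'
    have hWt : W ≠ ⊤ := by rw [hW']; exact ENNReal.ofReal_ne_top
    have heq : (ENNReal.ofReal (K₀ * ε) ^ d * ENNReal.ofReal ((b - a) ^ N)) ^ 2 =
        W * ENNReal.ofReal ((K₀ ^ d) ^ 2 * (b - a) ^ N / (K₁ ^ d * C)) := by
      rw [hW', ← ENNReal.ofReal_mul (by positivity), ← ENNReal.ofReal_pow (by positivity),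
        ← ENNReal.ofReal_mul (by positivity), ← ENNReal.ofReal_pow (by positivity)]
      congr 1
      field_simp
      ring
    rw [heq, mul_assoc W En, ENNReal.mul_le_mul_iff_right hW0 hWt, mul_comm En] at hmain
    exact ENNReal.div_le_of_le_mul hmain
  have hεpos : ∀ n : ℕ, (0 : ℝ) < 1 / ((n : ℝ) + 1) := fun n => Nat.one_div_pos_of_nat
  have hεle : ∀ n : ℕ, 1 / ((n : ℝ) + 1) ≤ 1 := fun n => by
    rw [div_le_one (by positivity)]; linarith [n.cast_nonneg (α := ℝ)]
  choose B hB hBsub hBle using fun n : ℕ => key _ (hεpos n) (hεle n)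
  -- The limsup of the events `B n` inherits their uniform lower bound by continuity from above; on
  -- it, the path comes arbitrarily close to `A`.
  set U : ℕ → Set Ω := fun n => ⋃ m ≥ n, B m with hU
  have hUm : ∀ n, MeasurableSet (U n) := fun n =>
    MeasurableSet.biUnion (Set.to_countable _) fun m _ => hB m
  have hUanti : Antitone U := fun n n' hn => Set.biUnion_mono (fun m hm => le_trans hn hm)
    fun _ _ => le_rfl
  have hlim := tendsto_measure_iInter_atTop (μ := P) (fun n => (hUm n).nullMeasurableSet) hUanti
    ⟨0, measure_ne_top _ _⟩
  have hge := ge_of_tendsto' hlim fun n => (hBle n).trans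
    (measure_mono (Set.subset_biUnion_of_mem (u := B) (le_refl n : n ≥ n)))
  refine hge.trans (measure_mono_ae ?_)
  filter_upwards [hYX] with ω hω hmem
  have hQc : IsCompact Q := isCompact_Icc
  obtain ⟨t, ht, htA⟩ := exists_mem_of_frequently_near hd (hYc ω) hQc hA fun δ hδ => by
    obtain ⟨n, hn⟩ := exists_nat_one_div_lt hδ
    obtain ⟨m, hm, hmB⟩ := Set.mem_iUnion₂.1 (Set.mem_iInter.1 hmem n)
    obtain ⟨t, ht, x, hx, h⟩ := hBsub m ω hmB
    refine ⟨t, ht, x, hx, fun j => (h j).trans ((Nat.one_div_le_one_div hm).trans hn.le)⟩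
  exact ⟨_, hcoeI t ht, by rwa [← hω t]⟩

theorem theorem3p9 {N d : ℕ} (hN : 1 ≤ N) (hd : 1 ≤ d) (H : ℝ) (hH0 : 0 < H) (hH1 : H < 1)
    (c : ℝ) (hc : 0 < c) (a b M : ℝ) (ha : 0 < a) (hab : a < b) (hM : 0 < M) :
    ∃ K : ℝ, 0 < K ∧
      ∀ (Ω : Type*) [MeasurableSpace Ω] (P : Measure Ω) [IsProbabilityMeasure P]
        (X : (Fin N → ℝ≥0) → Ω → EuclideanSpace ℝ (Fin d)),
        IsFractionalBrownianSheet H c X P →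
        ∀ A : Set (EuclideanSpace ℝ (Fin d)), IsCompact A → A ⊆ Metric.ball 0 M →
          ENNReal.ofReal K * newtonCapacity M ((d : ℝ) - (N : ℝ) / H) A ≤
            P {ω | ∃ t : Fin N → ℝ≥0, (∀ i, a ≤ (t i : ℝ) ∧ (t i : ℝ) ≤ b) ∧ X t ω ∈ A} := by
  obtain ⟨K, hK, hbd⟩ := exists_hitting_bound hN hd hH0 hH1 hc ha hab hM
  refine ⟨K, hK, fun Ω _ P _ X hX A hA hAM => ?_⟩
  have hbd := hbd Ω P X hX A hA hAM
  rw [newtonCapacity]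
  split_ifs with hβ hne
  · obtain ⟨x, hx⟩ := hne
    -- For a negative exponent the kernel is constantly `1`, so a point mass has energy `1`,
    -- matching the capacity.
    have := hbd (Measure.dirac x) inferInstance
      (by rw [Measure.dirac_apply' _ hA.isClosed.measurableSet.compl]; simp [hx])
    have hone : ∀ w : EuclideanSpace ℝ (Fin d), hittingKernel M ((d : ℝ) - N / H) w = 1 :=
      fun w => if_pos hβ
    simpa only [kernelEnergy, hone, lintegral_one, measure_univ, inv_one] using this
  · simp
  · have hker : (hittingKernel M ((d : ℝ) - N / H) : EuclideanSpace ℝ (Fin d) → ℝ≥0∞) =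
        newtonKernel M ((d : ℝ) - N / H) := funext fun w => if_neg hβ
    rw [hker] at hbd
    rw [kernelCapacity]
    simp only [ENNReal.inv_iInf, ENNReal.mul_iSup]
    exact iSup_le fun μ => iSup_le fun h1 => iSup_le fun h2 => hbd μ h1 h2
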